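/- Let $(R,\mathfrak m)$ be a Noetherian local ring of prime characteristic $p>0$ and Krull dimension $d>0$. Let $I$ and $\mathfrak a$ be $\mathfrak m$-primary ideals of $R$, let $M$ be a finitely generated $R$-module, and let $t>0$ be a real number. For $q=p^e$ with $e\ge 0$, let $I^{[q]}$ be the ideal generated by all $i^q$ with $i\in I$, and put $$\ell_M(q)=\lambda_R\left(\frac{M}{\mathfrak a^{\lceil tq\rceil}I^{[q]}M}\right),$$ where $\lambda_R$ denotes length. Then $\ell_M(q)$ is finite for every $q$, and there is a unique real number $c$ such that $$\ell_M(q)=c\,q^d+O(q^{d-1})\qquad (q=p^e,\ e\to\infty).$$ Moreover $c\ge 0$, and $c>0$ if and only if $\dim M=d$, where $\dim M$ is the Krull dimension of the support of $M$. In particular, for $M=R$ the constant $c$ is positive; it equals $\lim_{e\to\infty}\ell_R(p^e)/p^{ed}$ and is called the joint Hilbert–Kunz multiplicity $e_{HK}(\mathfrak a^t,I)$. -/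

import Mathlib

open Filter Asymptotics

namespace JointHK

/-- The Frobenius (bracket) power `I^[q]`: the ideal generated by all `i ^ q` with `i ∈ I`. -/
def bracketPower {R : Type*} [CommRing R] (I : Ideal R) (q : ℕ) : Ideal R :=
  Ideal.span ((fun i : R => i ^ q) '' (I : Set R))

/-- An ideal of a local ring is primary to the maximal ideal. -/
def IsMPrimary {R : Type*} [CommRing R] [IsLocalRing R] (I : Ideal R) : Prop :=
  I.IsPrimary ∧ I.radical = IsLocalRing.maximalIdeal R

/-- The length (possibly `⊤`) of the `R`-module `M / 𝔞^⌈tq⌉ I^[q] M`. -/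
noncomputable def jointLength {R : Type*} [CommRing R] (𝔞 I : Ideal R) (t : ℝ)
    (M : Type*) [AddCommGroup M] [Module R M] (q : ℕ) : ℕ∞ :=
  Module.length R
    (M ⧸ ((𝔞 ^ ⌈t * (q : ℝ)⌉₊ * bracketPower I q) • (⊤ : Submodule R M)))

/-- The same length as a real number; the value is meaningful where the length is finite. -/
noncomputable def ell {R : Type*} [CommRing R] (𝔞 I : Ideal R) (t : ℝ)
    (M : Type*) [AddCommGroup M] [Module R M] (q : ℕ) : ℝ :=
  ((jointLength 𝔞 I t M q).toNat : ℝ)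

/-- `ℓ_M(q) = c q^d + O(q^(d-1))` as `q = p^e` runs through the powers of `p` (for `d ≥ 1`). -/
def HasLeadingCoeff {R : Type*} [CommRing R] (p d : ℕ) (𝔞 I : Ideal R) (t : ℝ)
    (M : Type*) [AddCommGroup M] [Module R M] (c : ℝ) : Prop :=
  (fun e : ℕ => ell 𝔞 I t M (p ^ e) - c * ((p : ℝ) ^ e) ^ d)
    =O[atTop] (fun e : ℕ => ((p : ℝ) ^ e) ^ (d - 1))

/-- The joint Hilbert–Kunz multiplicity `e_HK(𝔞^t, I)` of a ring of dimension `d`: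
the limit of `ℓ_R(q) / q^d` over the powers `q = p^e`. -/
noncomputable def jointHKMultiplicity {R : Type*} [CommRing R] (p d : ℕ) (𝔞 I : Ideal R)
    (t : ℝ) : ℝ :=
  limUnder atTop (fun e : ℕ => ell 𝔞 I t R (p ^ e) / ((p : ℝ) ^ e) ^ d)

end JointHK

/-!
Write `ℓ_M(q)` for the length of `M / 𝔞 ^ ⌈tq⌉ I^[q] M`, where `q = p ^ e`, and `d = dim R`. The
argument is Monsky's: it compares `ℓ_M(p q)` with `ℓ_M(q)` through the Frobenius pushforward.

*Order of growth.* The ideal `𝔞 ^ ⌈tq⌉ I^[q]` contains a power of `𝔪` of exponent linear in `q`, and is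
contained in `𝔪 ^ ⌈tq⌉`. Hence `ℓ_M(q)` has exact order `q ^ dim M`, by the two-sided estimate of
Hilbert–Samuel functions in `exists_length_quotient_pow_le` and `exists_pow_le_length_quotient_pow`.
In particular a homomorphism whose cokernel vanishes at all minimal primes yields an inequality of
lengths up to `O(q ^ (d - 1))` (`leUpTo_of_coker`).

*Rings with finite Frobenius and perfect residue field.* The length of `F_* M` modulo an ideal `J` is
that of `M` modulo the image ideal `J^[p]`, and `(𝔞 ^ ⌈tq⌉ I^[q])^[p]` agrees with `𝔞 ^ ⌈tpq⌉ I^[pq]` up to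
a bounded power of `𝔞`, which costs only `O(q ^ (d - 1))`; so `ℓ_{F_* M}(q) = ℓ_M(p q) + O(q ^ (d - 1))`.
For a minimal prime `P` the module `F_* (R / P)` is generically free over `R / P`, of rank `r` say.
Therefore `ℓ(p q) = r ℓ(q) + O(q ^ (d - 1))` for `M = R / P`. If `dim R / P = d`, the order of growth
forces `r = p ^ d`, and then `ℓ(q) / q ^ d` converges with error `O(1 / q)` (`hasCoeff_of_recursion`).
A module killed by the nilradical is generically the direct sum of its reductions modulo the minimal
primes, and those are generically free. For an arbitrary `M` some iterated pushforward of `M` is killed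
by the nilradical, and passing to it only shifts `e` (`hasCoeff_of_finite_frobenius`).

*Reduction to that case.* The completion of `R` contains a coefficient field `κ`, because every field of
characteristic `p` is formally smooth over its prime field (`formallySmooth_zmod`). Tensoring over
`κ` with an algebraic closure and completing again gives a local ring `S` with `𝔪 S` as its maximal ideal
and an algebraically closed coefficient field. It is a quotient of a power series ring, so it is
Noetherian, and completeness makes its Frobenius finite. Every step preserves the lengths of `M / J M`
for cofinite `J`, the first two by flatness (`length_quotient_map_smul_adicCompletion`), so the
expansion over `S` is one over `R`. The dimension of `S` is at most `d` because the Hilbert–Samuel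
functions of `R` and `S` coincide.
-/

namespace JointHK

/-! ### Lengths of subquotients -/

section Length

variable {R : Type*} [CommRing R] {M N : Type*} [AddCommGroup M] [Module R M]
  [AddCommGroup N] [Module R N]

/-- The length of `(B + A) / A` for submodules `A`, `B` of a module, realized as the image of `B`
in the quotient by `A`; no inclusion between `A` and `B` is assumed. -/
noncomputable def relLength (B A : Submodule R M) : ℕ∞ :=
  Module.length R (B.map A.mkQ)

lemma length_quotient_eq_relLength_add (B A : Submodule R M) :
    Module.length R (M ⧸ A) = relLength B A + Module.length R (M ⧸ (A ⊔ B)) := by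
  refine Module.length_eq_add_of_exact (B.map A.mkQ).subtype
    (Submodule.factor (le_sup_left : A ≤ A ⊔ B)) (Submodule.subtype_injective _)
    (Submodule.factor_surjective _) ?_
  rw [LinearMap.exact_iff, Submodule.range_subtype]
  ext x
  obtain ⟨x, rfl⟩ := A.mkQ_surjective x
  rw [LinearMap.mem_ker, show Submodule.factor le_sup_left (A.mkQ x) = (A ⊔ B).mkQ x from rfl,
    Submodule.mkQ_apply _ x, Submodule.Quotient.mk_eq_zero, Submodule.mem_map]
  constructor
  · intro h
    obtain ⟨a, ha, b, hb, rfl⟩ := Submodule.mem_sup.1 h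
    refine ⟨b, hb, ?_⟩
    rw [Submodule.mkQ_apply, Submodule.mkQ_apply, Submodule.Quotient.eq]
    simpa using A.neg_mem ha
  · rintro ⟨b, hb, hbx⟩
    rw [Submodule.mkQ_apply, Submodule.mkQ_apply, Submodule.Quotient.eq] at hbx
    have : x = -(b - x) + b := by abel
    rw [this]
    exact Submodule.add_mem_sup (A.neg_mem hbx) hb

lemma length_quotient_eq_relLength_add_of_le {A B : Submodule R M} (h : A ≤ B) :
    Module.length R (M ⧸ A) = relLength B A + Module.length R (M ⧸ B) := by
  rw [length_quotient_eq_relLength_add B A, sup_eq_right.2 h]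

lemma length_quotient_anti {A B : Submodule R M} (h : A ≤ B) :
    Module.length R (M ⧸ B) ≤ Module.length R (M ⧸ A) :=
  Module.length_le_of_surjective (Submodule.factor h) (Submodule.factor_surjective h)

lemma relLength_map_le (f : M →ₗ[R] N) {B A : Submodule R M} {A' : Submodule R N}
    (h : A.map f ≤ A') : relLength (B.map f) A' ≤ relLength B A := by
  have h' : A ≤ A'.comap f := Submodule.map_le_iff_le_comap.1 h
  have e : (B.map f).map A'.mkQ = (B.map A.mkQ).map (A.mapQ A' f h') := by
    rw [← Submodule.map_comp, ← Submodule.map_comp, Submodule.mapQ_mkQ]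
  rw [relLength, relLength, e]
  exact Module.length_le_of_surjective _ ((A.mapQ A' f h').submoduleMap_surjective _)

lemma length_sup_le (P Q : Submodule R M) :
    Module.length R ↥(P ⊔ Q) ≤ Module.length R P + Module.length R Q := by
  rw [← Module.length_prod R P Q]
  refine Module.length_le_of_surjective
    ((Submodule.inclusion (le_sup_left : P ≤ P ⊔ Q)).coprod
      (Submodule.inclusion (le_sup_right : Q ≤ P ⊔ Q))) ?_
  rintro ⟨x, hx⟩
  obtain ⟨a, ha, b, hb, rfl⟩ := Submodule.mem_sup.1 hx
  exact ⟨(⟨a, ha⟩, ⟨b, hb⟩), Subtype.ext (by simp)⟩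

lemma relLength_sup_le (B C A : Submodule R M) :
    relLength (B ⊔ C) A ≤ relLength B A + relLength C A := by
  rw [relLength, Submodule.map_sup]
  exact length_sup_le _ _

lemma relLength_bot (A : Submodule R M) : relLength ⊥ A = 0 := by
  rw [relLength, Submodule.map_bot, Module.length_bot]

lemma relLength_finset_sup_le {ι : Type*} (s : Finset ι) (B : ι → Submodule R M)
    (A : Submodule R M) : relLength (s.sup B) A ≤ ∑ i ∈ s, relLength (B i) A := by
  classical
  induction s using Finset.induction_on with
  | empty => simp [relLength_bot]
  | insert a s ha ih =>
    rw [Finset.sup_insert, Finset.sum_insert ha]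
    exact (relLength_sup_le _ _ _).trans (by gcongr)

lemma length_quotient_smul_eq_relLength_ker_add {Q : Type*} [AddCommGroup Q] [Module R Q]
    (g : N →ₗ[R] Q) (hg : Function.Surjective g) (J : Ideal R) :
    Module.length R (N ⧸ (J • ⊤ : Submodule R N)) =
      relLength (LinearMap.ker g) (J • ⊤) + Module.length R (Q ⧸ (J • ⊤ : Submodule R Q)) := by
  rw [length_quotient_eq_relLength_add (LinearMap.ker g) (J • ⊤ : Submodule R N)]
  congr 1
  let φ : N →ₗ[R] Q ⧸ (J • ⊤ : Submodule R Q) := (Submodule.mkQ _).comp g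
  have hφ : LinearMap.ker φ = J • ⊤ ⊔ LinearMap.ker g := by
    have : (J • ⊤ : Submodule R Q) = (J • ⊤ : Submodule R N).map g := by
      rw [Submodule.map_smul'', Submodule.map_top, LinearMap.range_eq_top.2 hg]
    rw [LinearMap.ker_comp, Submodule.ker_mkQ, this, Submodule.comap_map_eq]
  rw [← hφ]
  exact (φ.quotKerEquivOfSurjective ((Submodule.mkQ_surjective _).comp hg)).length_eq

/-- Right exactness of `M ↦ M / J M`: a cokernel `Q` of `f : M → N` bounds the length of `N / J N`
in terms of `M / J M`. -/
lemma length_quotient_smul_le_of_exact {Q : Type*} [AddCommGroup Q] [Module R Q]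
    (f : M →ₗ[R] N) (g : N →ₗ[R] Q) (hg : Function.Surjective g) (hfg : Function.Exact f g)
    (J : Ideal R) :
    Module.length R (N ⧸ (J • ⊤ : Submodule R N)) ≤
      Module.length R (M ⧸ (J • ⊤ : Submodule R M)) +
        Module.length R (Q ⧸ (J • ⊤ : Submodule R Q)) := by
  rw [length_quotient_smul_eq_relLength_ker_add g hg, LinearMap.exact_iff.1 hfg]
  gcongr
  rw [← Submodule.map_top f]
  refine (relLength_map_le (A := J • ⊤) f ?_).trans ?_
  · rw [Submodule.map_smul'']
    exact Submodule.smul_mono le_rfl le_top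
  · rw [relLength, Submodule.map_top, Submodule.range_mkQ, Module.length_top]

lemma length_quotient_smul_le_of_surjective (f : M →ₗ[R] N) (hf : Function.Surjective f)
    (J : Ideal R) :
    Module.length R (N ⧸ (J • ⊤ : Submodule R N)) ≤
      Module.length R (M ⧸ (J • ⊤ : Submodule R M)) := by
  have h : (J • ⊤ : Submodule R M) ≤ (J • ⊤ : Submodule R N).comap f := by
    rw [← Submodule.map_le_iff_le_comap, Submodule.map_smul'']
    exact Submodule.smul_mono le_rfl le_top
  refine Module.length_le_of_surjective (Submodule.mapQ _ _ f h) ?_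
  intro y
  obtain ⟨y, rfl⟩ := Submodule.mkQ_surjective _ y
  obtain ⟨x, rfl⟩ := hf y
  exact ⟨Submodule.mkQ _ x, by simp⟩

lemma pow_succ_smul_le (𝔞 : Ideal R) (n : ℕ) :
    (𝔞 ^ (n + 1) • ⊤ : Submodule R M) ≤ 𝔞 ^ n • ⊤ :=
  Submodule.smul_mono (Ideal.pow_le_pow_right n.le_succ) le_rfl

open scoped Pointwise

lemma relLength_range_smul_le {𝔞 : Ideal R} {x : R} (hx : x ∈ 𝔞) (n : ℕ) :
    relLength (LinearMap.ker (Submodule.mkQ (x • (⊤ : Submodule R M)))) (𝔞 ^ (n + 1) • ⊤) ≤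
      Module.length R (M ⧸ (𝔞 ^ n • ⊤ : Submodule R M)) := by
  rw [Submodule.ker_mkQ]
  have h1 : x • (⊤ : Submodule R M) = (⊤ : Submodule R M).map (LinearMap.lsmul R M x) := rfl
  rw [h1]
  refine (relLength_map_le (A := 𝔞 ^ n • ⊤) _ ?_).trans ?_
  · rw [Submodule.map_smul'', pow_succ, mul_smul]
    refine Submodule.smul_mono le_rfl ?_
    rintro _ ⟨m, -, rfl⟩
    exact Submodule.smul_mem_smul hx trivial
  · rw [relLength, Submodule.map_top, Submodule.range_mkQ, Module.length_top]

lemma length_quotient_pow_succ_le {𝔞 : Ideal R} {x : R} (hx : x ∈ 𝔞) (n : ℕ) :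
    Module.length R (M ⧸ (𝔞 ^ (n + 1) • ⊤ : Submodule R M)) ≤
      Module.length R (M ⧸ (𝔞 ^ n • ⊤ : Submodule R M)) +
      Module.length R (QuotSMulTop x M ⧸ (𝔞 ^ (n + 1) • ⊤ : Submodule R (QuotSMulTop x M))) := by
  rw [length_quotient_smul_eq_relLength_ker_add (N := M) (Q := QuotSMulTop x M)
    (Submodule.mkQ (x • (⊤ : Submodule R M))) (Submodule.mkQ_surjective _)]
  gcongr
  exact relLength_range_smul_le hx n

end Length

/-! ### Ordinary powers against bracket powers -/

section Powers

variable {R : Type*} [CommRing R]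

lemma span_pow_le_span_image_pow (s : Finset R) {q : ℕ} (hq : 0 < q) :
    Ideal.span (s : Set R) ^ (q * (s.card + 1)) ≤ Ideal.span ((fun x => x ^ q) '' (s : Set R)) := by
  classical
  induction s using Finset.induction_on with
  | empty =>
    rw [Finset.coe_empty, Ideal.span_empty, ← Ideal.zero_eq_bot, zero_pow (by simp [hq.ne'])]
    exact bot_le
  | insert a s ha ih =>
    rw [Finset.card_insert_of_notMem ha, Finset.coe_insert, Ideal.span_insert, Set.image_insert_eq,
      Ideal.span_insert, show q * (s.card + 1 + 1) = q + q * (s.card + 1) by ring]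
    refine Ideal.sup_pow_add_le_pow_sup_pow.trans (sup_le_sup ?_ ih)
    rw [Ideal.span_singleton_pow]

/-- A finitely generated ideal satisfies `I ^ (μ q) ≤ I^[q]` for a constant `μ`. -/
lemma exists_pow_le_bracketPower {I : Ideal R} (hI : I.FG) :
    ∃ μ : ℕ, ∀ q, 0 < q → I ^ (q * μ) ≤ bracketPower I q := by
  obtain ⟨s, rfl⟩ := hI
  exact ⟨s.card + 1, fun q hq => (span_pow_le_span_image_pow s hq).trans
    (Ideal.span_mono (Set.image_mono Ideal.subset_span))⟩

lemma span_pow_le_span_image_pow_pow (s : Finset R) {q : ℕ} (hq : 0 < q) (n : ℕ) :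
    Ideal.span (s : Set R) ^ (q * n + q * (s.card + 1)) ≤
      Ideal.span ((fun x => x ^ q) '' (s : Set R)) ^ n := by
  classical
  induction s using Finset.induction_on generalizing n with
  | empty =>
    rw [Finset.coe_empty, Ideal.span_empty, ← Ideal.zero_eq_bot, zero_pow (by simp [hq.ne'])]
    exact bot_le
  | insert a s ha ih =>
    rw [Finset.card_insert_of_notMem ha, Finset.coe_insert, Ideal.span_insert, Set.image_insert_eq,
      Ideal.span_insert]
    set J := Ideal.span (s : Set R)
    set J' := Ideal.span ((fun x => x ^ q) '' (s : Set R))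
    rw [← Ideal.add_eq_sup, add_pow, ← Ideal.add_eq_sup]
    refine Finset.sum_induction _ (· ≤ _) (fun _ _ => sup_le) bot_le fun i _ => ?_
    refine Ideal.mul_le_left.trans ?_
    -- split off from the exponent of `a` the largest multiple `q * (i / q)` of `q`
    have hi1 : q * (i / q) ≤ i := Nat.mul_div_le i q
    have hi2 : i < q * (i / q) + q := by
      have := Nat.lt_div_mul_add (a := i) hq; rw [mul_comm] at this; exact this
    have ha' : Ideal.span {a} ^ i ≤ Ideal.span {a ^ q} ^ (i / q) := by
      refine (Ideal.pow_le_pow_right hi1).trans ?_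
      rw [pow_mul, Ideal.span_singleton_pow]
    set K := Ideal.span {a ^ q} + J'
    have haK : Ideal.span {a ^ q} ≤ K := le_sup_left
    have hJK : J' ≤ K := le_sup_right
    rcases le_total n (i / q) with h | h
    · exact Ideal.mul_le_left.trans (ha'.trans ((Ideal.pow_right_mono haK _).trans
        (Ideal.pow_le_pow_right h)))
    · obtain ⟨m, rfl⟩ := Nat.exists_eq_add_of_le h
      rw [pow_add K]
      refine Ideal.mul_mono (ha'.trans (Ideal.pow_right_mono haK _)) ?_
      refine (Ideal.pow_le_pow_right ?_).trans ((ih m).trans (Ideal.pow_right_mono hJK _))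
      have : q * (i / q + m) + q * (s.card + 1 + 1) =
        q * (i / q) + q + (q * m + q * (s.card + 1)) := by ring
      omega

lemma bracketPower_eq_map (p : ℕ) [ExpChar R p] (I : Ideal R) (e : ℕ) :
    bracketPower I (p ^ e) = I.map (iterateFrobenius R p e) := rfl

/-- The ideal `I^[p]` contains the ordinary powers of `I` with linear growth: for a finitely
generated `I` there is a constant `c` with `I ^ (p n + c) ≤ (I^[p]) ^ n` for every `n`. -/
lemma exists_pow_le_map_frobenius_pow (p : ℕ) [ExpChar R p] {I : Ideal R} (hI : I.FG) :
    ∃ c : ℕ, ∀ n, I ^ (p * n + c) ≤ (I.map (frobenius R p)) ^ n := by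
  obtain ⟨s, rfl⟩ := hI
  refine ⟨p * (s.card + 1), fun n => ?_⟩
  rw [Ideal.map_span]
  exact span_pow_le_span_image_pow_pow s (expChar_pos R p) n

lemma map_frobenius_le_pow (p : ℕ) [ExpChar R p] (I : Ideal R) :
    I.map (frobenius R p) ≤ I ^ p := by
  rw [Ideal.map_le_iff_le_comap]
  exact fun x hx => Ideal.pow_mem_pow hx p

lemma map_frobenius_bracketPower (p : ℕ) [ExpChar R p] (I : Ideal R) (e : ℕ) :
    (bracketPower I (p ^ e)).map (frobenius R p) = bracketPower I (p ^ (e + 1)) := by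
  rw [bracketPower_eq_map, bracketPower_eq_map, Ideal.map_map]
  congr 1
  ext x
  simp [iterateFrobenius_def, frobenius_def, pow_succ, pow_mul]

lemma bracketPower_span (p : ℕ) [ExpChar R p] (s : Set R) (e : ℕ) :
    bracketPower (Ideal.span s) (p ^ e) = Ideal.span ((fun x => x ^ p ^ e) '' s) := by
  rw [bracketPower_eq_map, Ideal.map_span]
  rfl

end Powers

/-! ### Growth of Hilbert–Samuel functions -/

section HilbertSamuel

open IsLocalRing

open scoped Pointwise

lemma withBot_le_of_add_one_le {a : WithBot ℕ∞} {s : ℕ} (h : a + 1 ≤ (s + 1 : ℕ)) :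
    a ≤ (s : ℕ) := by
  cases a with
  | bot => exact bot_le
  | coe a =>
    have h' : a + 1 ≤ (s : ℕ∞) + 1 := by exact_mod_cast h
    exact_mod_cast (ENat.add_le_add_iff_right (by simp)).1 h'

lemma exists_pow_le_pow {R : Type*} [CommRing R] [IsLocalRing R] {𝔞 : Ideal R}
    (h𝔞 : ∃ k, maximalIdeal R ^ k ≤ 𝔞) (n : ℕ) :
    ∃ k, maximalIdeal R ^ k ≤ 𝔞 ^ n := by
  obtain ⟨k, hk⟩ := h𝔞
  exact ⟨k * n, by rw [pow_mul]; exact Ideal.pow_right_mono hk n⟩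

variable {R : Type*} [CommRing R] [IsLocalRing R] [IsNoetherianRing R]

lemma isArtinianRing_quotient_of_pow_le {J : Ideal R} (hJ : ∃ k, maximalIdeal R ^ k ≤ J) :
    IsArtinianRing (R ⧸ J) := by
  obtain ⟨k, hk⟩ := hJ
  by_cases hJ : J = ⊤
  · have : Subsingleton (R ⧸ J) := Ideal.Quotient.subsingleton_iff.2 hJ
    infer_instance
  · refine quotient_artinian_of_mem_minimalPrimes_of_isLocalRing J
      ⟨⟨inferInstance, le_maximalIdeal hJ⟩, fun q hq _ => ?_⟩
    have := hq.1
    exact Ideal.IsPrime.le_of_pow_le (hk.trans hq.2)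

section

variable (M : Type*) [AddCommGroup M] [Module R M] [Module.Finite R M]

lemma length_quotient_smul_ne_top {J : Ideal R} (hJ : ∃ k, maximalIdeal R ^ k ≤ J) :
    Module.length R (M ⧸ (J • ⊤ : Submodule R M)) ≠ ⊤ := by
  have := isArtinianRing_quotient_of_pow_le hJ
  rw [Module.length_eq_of_surjective (S := R) (R := R ⧸ J) Ideal.Quotient.mk_surjective]
  have : Module.Finite (R ⧸ J) (M ⧸ (J • ⊤ : Submodule R M)) :=
    Module.Finite.of_restrictScalars_finite R _ _
  exact Module.length_ne_top

lemma exists_pow_le_annihilator_of_supportDim_le_zero (h : Module.supportDim R M ≤ 0) :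
    ∃ k, maximalIdeal R ^ k ≤ Module.annihilator R M := by
  cases subsingleton_or_nontrivial M with
  | inl hM => exact ⟨0, by rw [Module.annihilator_eq_top_iff.2 hM]; exact le_top⟩
  | inr hM =>
    have h0 : Module.supportDim R M = 0 := le_antisymm h (by
      have := Module.supportDim_ne_bot_of_nontrivial R M
      rw [← WithBot.coe_unbot _ this]
      exact WithBot.coe_le_coe.2 zero_le)
    have h1 := support_of_supportDim_eq_zero R M h0
    rw [Module.support_eq_zeroLocus, PrimeSpectrum.zeroLocus_eq_iff] at h1
    have h2 := Ideal.exists_radical_pow_le_of_fg (Module.annihilator R M)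
      (IsNoetherian.noetherian _)
    rwa [h1, (maximalIdeal.isMaximal R).isPrime.radical] at h2

/-- Prime avoidance: an `𝔪`-primary ideal contains an element cutting down the dimension of a
given module of positive dimension. -/
lemma exists_mem_supportDim_quotSMulTop_le {𝔞 : Ideal R} (h𝔞 : ∃ k, maximalIdeal R ^ k ≤ 𝔞)
    (s : ℕ) (h : Module.supportDim R M ≤ (s + 1 : ℕ)) :
    ∃ x ∈ 𝔞, Module.supportDim R (QuotSMulTop x M) ≤ (s : ℕ) := by
  by_cases hm : maximalIdeal R ∈ (Module.annihilator R M).minimalPrimes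
  · refine ⟨0, 𝔞.zero_mem, (Module.supportDim_le_of_surjective _
      (Submodule.mkQ_surjective _)).trans ?_⟩
    have := quotient_artinian_of_mem_minimalPrimes_of_isLocalRing _ hm
    rw [Module.supportDim_eq_ringKrullDim_quotient_annihilator]
    exact ((Ring.krullDimLE_iff (n := 0)).1 inferInstance).trans (by exact_mod_cast zero_le)
  · have hav : ¬ ((𝔞 : Set R) ⊆ ⋃ P ∈ (Module.annihilator R M).minimalPrimes, P) := by
      intro hsub
      obtain ⟨P, hP, hle⟩ := (Ideal.subset_union_prime_finite (f := fun P => P)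
        (Module.annihilator R M).finite_minimalPrimes_of_isNoetherianRing ⊤ ⊤
        (fun P hP _ _ => hP.1.1)).1 hsub
      obtain ⟨k, hk⟩ := h𝔞
      have := hP.1.1
      have hle' : maximalIdeal R ≤ P := Ideal.IsPrime.le_of_pow_le (hk.trans hle)
      exact hm (by rwa [← (maximalIdeal.isMaximal R).eq_of_le hP.1.1.ne_top hle'] at hP)
    rw [Set.not_subset] at hav
    obtain ⟨x, hx, hxP⟩ := hav
    simp only [Set.mem_iUnion, not_exists] at hxP
    refine ⟨x, hx, ?_⟩
    have h1 := Module.supportDim_quotSMulTop_succ_le_of_notMem_minimalPrimes (M := M) hxP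
    have h2 := h1.trans h
    exact withBot_le_of_add_one_le h2

variable {M}

lemma relLength_pow_succ_le {𝔞 : Ideal R} (h𝔞 : ∃ k, maximalIdeal R ^ k ≤ 𝔞) {x : R} (hx : x ∈ 𝔞)
    (n : ℕ) :
    relLength (𝔞 ^ n • ⊤ : Submodule R M) (𝔞 ^ (n + 1) • ⊤) ≤
      Module.length R (QuotSMulTop x M ⧸ (𝔞 ^ (n + 1) • ⊤ : Submodule R (QuotSMulTop x M))) := by
  have h := length_quotient_pow_succ_le (M := M) hx n
  rw [length_quotient_eq_relLength_add_of_le (pow_succ_smul_le 𝔞 n), add_comm] at h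
  exact (ENat.add_le_add_iff_left (length_quotient_smul_ne_top M (exists_pow_le_pow h𝔞 n))).1 h

end

/-- Upper bound for Hilbert–Samuel functions. -/
theorem exists_length_quotient_pow_le {𝔞 : Ideal R} (h𝔞 : ∃ k, maximalIdeal R ^ k ≤ 𝔞) (s : ℕ)
    (M : Type*) [AddCommGroup M] [Module R M] [Module.Finite R M]
    (h : Module.supportDim R M ≤ s) :
    ∃ C : ℕ, ∀ n : ℕ, Module.length R (M ⧸ (𝔞 ^ n • ⊤ : Submodule R M)) ≤ C * (n : ℕ∞) ^ s := by
  induction s generalizing M with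
  | zero =>
    obtain ⟨k, hk⟩ := exists_pow_le_annihilator_of_supportDim_le_zero M (by simpa using h)
    have hfin := length_quotient_smul_ne_top M ⟨k, hk⟩
    rw [ENat.ne_top_iff_exists] at hfin
    obtain ⟨C, hC⟩ := hfin
    refine ⟨C, fun n => ?_⟩
    rw [pow_zero, mul_one, hC]
    refine length_quotient_anti ?_
    rw [Submodule.smul_le]
    intro r hr m _
    rw [Module.mem_annihilator.1 hr m]
    exact Submodule.zero_mem _
  | succ s ih =>
    obtain ⟨x, hx, hdim⟩ := exists_mem_supportDim_quotSMulTop_le M h𝔞 s h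
    obtain ⟨C, hC⟩ := ih _ hdim
    refine ⟨C, fun n => ?_⟩
    suffices H : Module.length R (M ⧸ (𝔞 ^ n • ⊤ : Submodule R M)) ≤
        ∑ i ∈ Finset.range n, C * ((i + 1 : ℕ) : ℕ∞) ^ s by
      refine H.trans ((Finset.sum_le_card_nsmul _ _ (C * (n : ℕ∞) ^ s) ?_).trans ?_)
      · intro i hi
        have : i + 1 ≤ n := Finset.mem_range.1 hi
        gcongr
      · rw [Finset.card_range, nsmul_eq_mul, pow_succ]
        exact le_of_eq (by ring)
    induction n with
    | zero =>
      simp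
    | succ n ihn =>
      rw [Finset.sum_range_succ]
      exact (length_quotient_pow_succ_le hx n).trans (add_le_add ihn (hC (n + 1)))

/-- Upper bound for the Hilbert function of the associated graded module. It needs no Hilbert
polynomial: the graded piece is dominated by the Hilbert–Samuel function of `M / x M` for a
parameter `x ∈ 𝔞`. -/
theorem exists_relLength_pow_succ_le {𝔞 : Ideal R} (h𝔞 : ∃ k, maximalIdeal R ^ k ≤ 𝔞) (s : ℕ)
    (M : Type*) [AddCommGroup M] [Module R M] [Module.Finite R M]
    (h : Module.supportDim R M ≤ (s + 1 : ℕ)) :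
    ∃ C : ℕ, ∀ n : ℕ, relLength (𝔞 ^ n • ⊤ : Submodule R M) (𝔞 ^ (n + 1) • ⊤) ≤
      C * ((n + 1 : ℕ) : ℕ∞) ^ s := by
  obtain ⟨x, hx, hdim⟩ := exists_mem_supportDim_quotSMulTop_le M h𝔞 s h
  obtain ⟨C, hC⟩ := exists_length_quotient_pow_le h𝔞 s _ hdim
  exact ⟨C, fun n => (relLength_pow_succ_le h𝔞 hx n).trans (hC (n + 1))⟩

end HilbertSamuel

section

variable {R : Type*} [CommRing R] {M N : Type*} [AddCommGroup M] [Module R M]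
  [AddCommGroup N] [Module R N]

lemma relLength_range (f : N →ₗ[R] M) (A : Submodule R M) :
    relLength (LinearMap.range f) A = Module.length R (N ⧸ A.comap f) := by
  have h1 : LinearMap.ker (A.mkQ.comp f) = A.comap f := by
    rw [LinearMap.ker_comp, Submodule.ker_mkQ]
  have h2 : LinearMap.range (A.mkQ.comp f) = (LinearMap.range f).map A.mkQ :=
    LinearMap.range_comp _ _
  rw [relLength, ← h1, ← h2]
  exact (LinearMap.quotKerEquivRange _).length_eq.symm

lemma le_length_quotient_of_injective (f : N →ₗ[R] M) {A : Submodule R M} {B : Submodule R N}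
    (h : A.comap f ≤ B) :
    Module.length R (N ⧸ B) ≤ Module.length R (M ⧸ A) := by
  rw [length_quotient_eq_relLength_add (LinearMap.range f) A, relLength_range]
  exact (length_quotient_anti h).trans le_self_add

/-- The Artin–Rees lemma, stated for an injective linear map. -/
lemma exists_comap_pow_smul_le [IsNoetherianRing R] [Module.Finite R M] (I : Ideal R)
    (f : N →ₗ[R] M) (hf : Function.Injective f) :
    ∃ k : ℕ, 0 < k ∧ ∀ n ≥ k,
      (I ^ n • ⊤ : Submodule R M).comap f ≤ (I ^ (n - k) • ⊤ : Submodule R N) := by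
  obtain ⟨k, hk⟩ := Ideal.exists_pow_inf_eq_pow_smul I (LinearMap.range f)
  refine ⟨k + 1, k.succ_pos, fun n hn y hy => ?_⟩
  have h1 : f y ∈ I ^ (n - k) • (I ^ k • ⊤ ⊓ LinearMap.range f) := by
    rw [← hk n (by omega)]
    exact ⟨hy, ⟨y, rfl⟩⟩
  have h2 : f y ∈ (I ^ (n - k) • ⊤ : Submodule R N).map f := by
    rw [Submodule.map_smul'', Submodule.map_top]
    exact Submodule.smul_mono le_rfl inf_le_right h1
  obtain ⟨z, hz, hzy⟩ := h2
  rw [hf hzy] at hz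
  exact Submodule.smul_mono (Ideal.pow_le_pow_right (by omega)) le_rfl hz

end

lemma add_pow_succ_le (m k s : ℕ) :
    (m + k) ^ (s + 1) ≤ m ^ (s + 1) + k * (s + 1) * (m + k) ^ s := by
  induction s with
  | zero => simp
  | succ s ih =>
    have h1 : m ^ (s + 1) ≤ (m + k) ^ (s + 1) := Nat.pow_le_pow_left (by omega) _
    calc (m + k) ^ (s + 1 + 1) = (m + k) * (m + k) ^ (s + 1) := by ring
      _ ≤ (m + k) * (m ^ (s + 1) + k * (s + 1) * (m + k) ^ s) := Nat.mul_le_mul_left _ ih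
      _ = m ^ (s + 1 + 1) + k * m ^ (s + 1) + k * (s + 1) * (m + k) ^ (s + 1) := by ring
      _ ≤ m ^ (s + 1 + 1) + k * (m + k) ^ (s + 1) + k * (s + 1) * (m + k) ^ (s + 1) := by gcongr
      _ = m ^ (s + 1 + 1) + k * (s + 1 + 1) * (m + k) ^ (s + 1) := by ring

/-- A function whose increments over steps of length `k` grow like `n ^ s` grows like
`n ^ (s + 1)`. -/
lemma exists_pow_succ_le_of_increment (g w : ℕ → ℕ) (s C k : ℕ) (hpos : ∀ n ≥ 1, 1 ≤ g n)
    (hk : 0 < k) (hg : ∀ n ≥ k, g (n - k) + w n ≤ g n) (hw : ∀ n ≥ 1, n ^ s ≤ C * w n) :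
    ∃ C' : ℕ, ∀ n ≥ 1, n ^ (s + 1) ≤ C' * g n := by
  refine ⟨k * (s + 1) * C + k ^ (s + 1), fun n => ?_⟩
  induction n using Nat.strong_induction_on with
  | h n ih =>
    intro hn
    rcases le_or_gt n k with hnk | hnk
    · calc n ^ (s + 1) ≤ k ^ (s + 1) * 1 := by rw [mul_one]; gcongr
        _ ≤ (k * (s + 1) * C + k ^ (s + 1)) * g n :=
          Nat.mul_le_mul (Nat.le_add_left _ _) (hpos n hn)
    · obtain ⟨m, rfl⟩ := Nat.exists_eq_add_of_le' hnk.le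
      have h1 := ih m (by omega) (by omega)
      have h2 := hg (m + k) (by omega)
      rw [Nat.add_sub_cancel] at h2
      calc (m + k) ^ (s + 1) ≤ m ^ (s + 1) + k * (s + 1) * (m + k) ^ s := add_pow_succ_le m k s
        _ ≤ (k * (s + 1) * C + k ^ (s + 1)) * g m + k * (s + 1) * (C * w (m + k)) := by
          gcongr
          exact hw _ hn
        _ ≤ (k * (s + 1) * C + k ^ (s + 1)) * g m
            + (k * (s + 1) * C + k ^ (s + 1)) * w (m + k) := by
          rw [← mul_assoc]
          gcongr
          exact Nat.le_add_right _ _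
        _ ≤ _ := by rw [← mul_add]; gcongr

section HilbertSamuelLower

open IsLocalRing

open scoped Pointwise

variable {R : Type*} [CommRing R] [IsLocalRing R] [IsNoetherianRing R]

lemma one_le_length_quotient_pow {R : Type*} [CommRing R] [IsLocalRing R] (M : Type*) [AddCommGroup M] [Module R M] [Module.Finite R M]
    [Nontrivial M] {n : ℕ} (hn : 1 ≤ n) :
    1 ≤ Module.length R (M ⧸ (maximalIdeal R ^ n • ⊤ : Submodule R M)) := by
  rw [Order.one_le_iff_ne_zero, Ne, Module.length_eq_zero_iff,
    Submodule.Quotient.subsingleton_iff]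
  intro h
  have h1 : (⊤ : Submodule R M) ≤ maximalIdeal R • ⊤ :=
    h.ge.trans (Submodule.smul_mono ((Ideal.pow_le_pow_right hn).trans (pow_one _).le) le_rfl)
  have := Submodule.eq_bot_of_le_smul_of_le_jacobson_bot _ _ (Module.Finite.fg_top) h1
    (maximalIdeal_le_jacobson _)
  exact top_ne_bot this

/-- A finite module of dimension at least `s` contains a copy of `R / Q` with `Q` prime and `R / Q` of
dimension at least `s`. -/
lemma exists_injective_of_le_supportDim {R : Type*} [CommRing R] [IsNoetherianRing R] (s : ℕ)
    (M : Type*) [AddCommGroup M] [Module R M] [Module.Finite R M]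
    (h : (s : WithBot ℕ∞) ≤ Module.supportDim R M) :
    ∃ Q : Ideal R, Q.IsPrime ∧ (∃ f : (R ⧸ Q) →ₗ[R] M, Function.Injective f) ∧
      ∃ l : LTSeries (PrimeSpectrum R), l.length = s ∧ Q ≤ l.head.asIdeal := by
  obtain ⟨l, hl⟩ := Order.le_krullDim_iff.1 h
  have hann : Module.annihilator R M ≤ l.head.1.asIdeal :=
    Module.mem_support_iff_of_finite.1 l.head.2
  have := l.head.1.isPrime
  obtain ⟨Q, hQ, hQl⟩ := Ideal.exists_minimalPrimes_le hann
  have hass := Module.associatedPrimes.minimalPrimes_annihilator_subset_associatedPrimes R M hQ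
  obtain ⟨hQp, hf⟩ := (isAssociatedPrime_iff_exists_injective_linearMap _ _).1 hass
  exact ⟨Q, hQp, hf, l.map Subtype.val (fun _ _ h => h), hl, hQl⟩

lemma exists_pow_le_length_of_injective (s : ℕ) {M N : Type*} [AddCommGroup M] [Module R M]
    [Module.Finite R M] [AddCommGroup N] [Module R N] [Nontrivial N] (f : N →ₗ[R] M)
    (hf : Function.Injective f)
    (h : ∃ C : ℕ, ∀ n : ℕ, 1 ≤ n →
      (n : ℕ∞) ^ s ≤ C * Module.length R (N ⧸ (maximalIdeal R ^ n • ⊤ : Submodule R N))) :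
    ∃ C : ℕ, ∀ n : ℕ, 1 ≤ n →
      (n : ℕ∞) ^ s ≤ C * Module.length R (M ⧸ (maximalIdeal R ^ n • ⊤ : Submodule R M)) := by
  obtain ⟨C, hC⟩ := h
  obtain ⟨k, hk0, hk⟩ := exists_comap_pow_smul_le (maximalIdeal R) f hf
  have : Nontrivial M := hf.nontrivial
  refine ⟨(k + 1) ^ s * C + k ^ s, fun n hn => ?_⟩
  push_cast
  rw [add_mul]
  rcases le_or_gt n k with hnk | hnk
  · refine le_trans ?_ le_add_self
    calc (n : ℕ∞) ^ s ≤ (k : ℕ∞) ^ s * 1 := by rw [mul_one]; gcongr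
      _ ≤ _ := by gcongr; exact one_le_length_quotient_pow M hn
  · refine le_trans ?_ le_self_add
    have h1 : n ≤ (k + 1) * (n - k) := by
      obtain ⟨m, rfl⟩ := Nat.exists_eq_add_of_lt hnk
      rw [show k + m + 1 - k = m + 1 by omega]
      nlinarith
    calc (n : ℕ∞) ^ s ≤ (((k + 1) * (n - k) : ℕ) : ℕ∞) ^ s := by gcongr
      _ = (k + 1 : ℕ∞) ^ s * ((n - k : ℕ) : ℕ∞) ^ s := by push_cast; rw [mul_pow]
      _ ≤ (k + 1 : ℕ∞) ^ s *
          (C * Module.length R (N ⧸ (maximalIdeal R ^ (n - k) • ⊤ : Submodule R N))) := by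
        gcongr
        exact hC _ (by omega)
      _ ≤ (k + 1 : ℕ∞) ^ s *
          (C * Module.length R (M ⧸ (maximalIdeal R ^ n • ⊤ : Submodule R M))) := by
        gcongr
        exact le_length_quotient_of_injective f (hk n hnk.le)
      _ = _ := by rw [mul_assoc]

lemma exists_pow_le_length_quotient_prime (s : ℕ) (Q : Ideal R) [Q.IsPrime]
    (l : LTSeries (PrimeSpectrum R)) (hl : l.length = s) (hQ : Q ≤ l.head.asIdeal) :
    ∃ C : ℕ, ∀ n : ℕ, 1 ≤ n →
      (n : ℕ∞) ^ s ≤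
        C * Module.length R ((R ⧸ Q) ⧸ (maximalIdeal R ^ n • ⊤ : Submodule R (R ⧸ Q))) := by
  induction s generalizing Q l with
  | zero =>
    refine ⟨1, fun n hn => ?_⟩
    have : Nontrivial (R ⧸ Q) := Ideal.Quotient.nontrivial_iff.2 (Ideal.IsPrime.ne_top ‹_›)
    simpa using one_le_length_quotient_pow (R ⧸ Q) hn
  | succ s ih =>
    have hne : l.length ≠ 0 := by omega
    have hlt : l.head < (l.tail hne).head := by
      rw [RelSeries.head_tail]
      refine l.strictMono ?_
      rw [Fin.lt_def]
      simp [hl]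
    obtain ⟨x, hx1, hx0⟩ := SetLike.exists_of_lt
      (show l.head.asIdeal < (l.tail hne).head.asIdeal from hlt)
    have hxQ : x ∉ Q := fun h => hx0 (hQ h)
    have hinj : Function.Injective (LinearMap.lsmul R (R ⧸ Q) x) := by
      rw [← LinearMap.ker_eq_bot, Submodule.eq_bot_iff]
      intro y hy
      obtain ⟨y, rfl⟩ := Ideal.Quotient.mk_surjective y
      rw [LinearMap.mem_ker, LinearMap.lsmul_apply, Algebra.smul_def, Ideal.Quotient.algebraMap_eq,
        ← map_mul, Ideal.Quotient.eq_zero_iff_mem] at hy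
      rw [Ideal.Quotient.eq_zero_iff_mem]
      exact (Ideal.IsPrime.mem_or_mem ‹_› hy).resolve_left hxQ
    have hnt : Nontrivial (R ⧸ Q) := Ideal.Quotient.nontrivial_iff.2 (Ideal.IsPrime.ne_top ‹_›)
    -- lower bound for `E = R / (Q + x)`
    have hE : ∃ C : ℕ, ∀ n : ℕ, 1 ≤ n → (n : ℕ∞) ^ s ≤ C * Module.length R
        (QuotSMulTop x (R ⧸ Q) ⧸ (maximalIdeal R ^ n • ⊤ : Submodule R (QuotSMulTop x (R ⧸ Q)))) := by
      have hdim : (s : WithBot ℕ∞) ≤ Module.supportDim R (QuotSMulTop x (R ⧸ Q)) := by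
        have hsupp : ∀ i, (l.tail hne) i ∈ Module.support R (QuotSMulTop x (R ⧸ Q)) := by
          intro i
          have hi : (l.tail hne).head ≤ (l.tail hne) i := (LTSeries.monotone (l.tail hne)) (Fin.zero_le i)
          rw [Module.support_quotSMulTop, Module.support_eq_zeroLocus, Ideal.annihilator_quotient]
          refine ⟨?_, ?_⟩
          · rw [PrimeSpectrum.mem_zeroLocus]
            exact hQ.trans (hlt.le.trans hi)
          · rw [PrimeSpectrum.mem_zeroLocus, Set.singleton_subset_iff]
            exact hi hx1
        refine Order.le_krullDim_iff.2 ⟨⟨(l.tail hne).length, fun i => ⟨_, hsupp i⟩,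
          fun i => (l.tail hne).step i⟩, ?_⟩
        simp [hl]
      obtain ⟨Q', hQ', ⟨f, hf⟩, l', hl', hQl'⟩ := exists_injective_of_le_supportDim s _ hdim
      have : Nontrivial (R ⧸ Q') := Ideal.Quotient.nontrivial_iff.2 (Ideal.IsPrime.ne_top ‹_›)
      exact exists_pow_le_length_of_injective s f hf (ih Q' l' hl' hQl')
    obtain ⟨C, hC⟩ := hE
    obtain ⟨k, hk0, hk⟩ := exists_comap_pow_smul_le (maximalIdeal R) _ hinj
    have hfinD : ∀ n : ℕ, ∃ g : ℕ, (g : ℕ∞) = Module.length R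
        ((R ⧸ Q) ⧸ (maximalIdeal R ^ n • ⊤ : Submodule R (R ⧸ Q))) := fun n =>
      ENat.ne_top_iff_exists.1 (length_quotient_smul_ne_top _ ⟨n, le_rfl⟩)
    have hfinE : ∀ n : ℕ, ∃ g : ℕ, (g : ℕ∞) = Module.length R
        (QuotSMulTop x (R ⧸ Q) ⧸ (maximalIdeal R ^ n • ⊤ : Submodule R (QuotSMulTop x (R ⧸ Q)))) :=
      fun n => ENat.ne_top_iff_exists.1 (length_quotient_smul_ne_top _ ⟨n, le_rfl⟩)
    choose g hg using hfinD
    choose w hw using hfinE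
    have hpos : ∀ n ≥ 1, 1 ≤ g n := fun n hn => by
      have h1 := one_le_length_quotient_pow (R := R) (R ⧸ Q) hn
      rw [← hg] at h1
      exact_mod_cast h1
    have hincr : ∀ n ≥ k, g (n - k) + w n ≤ g n := fun n hn => by
      have h1 := length_quotient_smul_eq_relLength_ker_add (N := R ⧸ Q)
        (Q := QuotSMulTop x (R ⧸ Q)) (Submodule.mkQ (x • (⊤ : Submodule R (R ⧸ Q))))
        (Submodule.mkQ_surjective _) (maximalIdeal R ^ n)
      have hker : LinearMap.ker (Submodule.mkQ (x • (⊤ : Submodule R (R ⧸ Q)))) =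
          LinearMap.range (LinearMap.lsmul R (R ⧸ Q) x) := by
        rw [Submodule.ker_mkQ, LinearMap.range_eq_map]
        rfl
      rw [hker, relLength_range, ← hg, ← hw] at h1
      have h2 := length_quotient_anti (hk n hn)
      rw [← hg] at h2
      have h3 : ((g (n - k) : ℕ∞) + w n) ≤ g n := h1 ▸ add_le_add h2 le_rfl
      exact_mod_cast h3
    have hpow : ∀ n ≥ 1, n ^ s ≤ C * w n := fun n hn => by
      have h1 := hC n hn
      rw [← hw] at h1
      exact_mod_cast h1
    obtain ⟨C', hC'⟩ := exists_pow_succ_le_of_increment g w s C k hpos hk0 hincr hpow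
    refine ⟨C', fun n hn => ?_⟩
    rw [← hg]
    exact_mod_cast hC' n hn

/-- Lower bound for Hilbert–Samuel functions. -/
theorem exists_pow_le_length_quotient_pow (s : ℕ) (M : Type*) [AddCommGroup M] [Module R M]
    [Module.Finite R M] (h : (s : WithBot ℕ∞) ≤ Module.supportDim R M) :
    ∃ C : ℕ, ∀ n : ℕ, 1 ≤ n →
      (n : ℕ∞) ^ s ≤ C * Module.length R (M ⧸ (maximalIdeal R ^ n • ⊤ : Submodule R M)) := by
  obtain ⟨Q, hQ, ⟨f, hf⟩, l, hl, hQl⟩ := exists_injective_of_le_supportDim s M h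
  have : Nontrivial (R ⧸ Q) := Ideal.Quotient.nontrivial_iff.2 (Ideal.IsPrime.ne_top ‹_›)
  exact exists_pow_le_length_of_injective s f hf (exists_pow_le_length_quotient_prime s Q l hl hQl)

end HilbertSamuelLower

/-! ### Comparison up to lower order terms -/

/-- `f ≤ g` up to an error `O(q ^ k)`, where `q = p ^ e` and `f`, `g` are functions of `e`. Working
with `ℕ∞`-valued functions avoids any finiteness assumption. -/
def LeUpTo (p k : ℕ) (f g : ℕ → ℕ∞) : Prop :=
  ∃ C : ℕ, ∀ e : ℕ, f e ≤ g e + C * ((p : ℕ∞) ^ e) ^ k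

namespace LeUpTo

variable {p k : ℕ} {f g h : ℕ → ℕ∞}

lemma of_le (H : ∀ e, f e ≤ g e) : LeUpTo p k f g := ⟨0, fun e => by simpa using H e⟩

lemma trans (H : LeUpTo p k f g) (H' : LeUpTo p k g h) : LeUpTo p k f h := by
  obtain ⟨C, hC⟩ := H
  obtain ⟨C', hC'⟩ := H'
  refine ⟨C' + C, fun e => (hC e).trans ?_⟩
  push_cast
  rw [add_mul, ← add_assoc]
  gcongr
  exact hC' e

end LeUpTo

/-! ### Bounds for the joint lengths -/

section Joint

open IsLocalRing

variable {R : Type*} [CommRing R] {M N : Type*} [AddCommGroup M] [Module R M]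
  [AddCommGroup N] [Module R N]

/-- The ideal `𝔞^⌈tq⌉ I^[q]`. -/
noncomputable def jointIdeal (𝔞 I : Ideal R) (t : ℝ) (q : ℕ) : Ideal R :=
  𝔞 ^ ⌈t * (q : ℝ)⌉₊ * bracketPower I q

lemma jointLength_eq (𝔞 I : Ideal R) (t : ℝ) (M : Type*) [AddCommGroup M] [Module R M] (q : ℕ) :
    jointLength 𝔞 I t M q =
      Module.length R (M ⧸ (jointIdeal 𝔞 I t q • ⊤ : Submodule R M)) := rfl

lemma ceil_mul_le (t : ℝ) (q : ℕ) : ⌈t * (q : ℝ)⌉₊ ≤ ⌈t⌉₊ * q := by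
  refine Nat.ceil_le.2 ?_
  push_cast
  gcongr
  exact Nat.le_ceil t

lemma relLength_mono {B B' : Submodule R M} (h : B ≤ B') (A : Submodule R M) :
    relLength B A ≤ relLength B' A :=
  Module.length_le_of_injective (Submodule.inclusion (Submodule.map_mono h))
    (Submodule.inclusion_injective _)

lemma length_quotient_pow_succ_mul_span_le (𝔞 : Ideal R) (s : Finset R) (n : ℕ) :
    Module.length R (M ⧸ ((𝔞 ^ (n + 1) * Ideal.span (s : Set R)) • ⊤ : Submodule R M)) ≤
      Module.length R (M ⧸ ((𝔞 ^ n * Ideal.span (s : Set R)) • ⊤ : Submodule R M)) +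
      s.card * relLength (𝔞 ^ n • ⊤ : Submodule R M) (𝔞 ^ (n + 1) • ⊤) := by
  set A := ((𝔞 ^ (n + 1) * Ideal.span (s : Set R)) • ⊤ : Submodule R M)
  set B := ((𝔞 ^ n * Ideal.span (s : Set R)) • ⊤ : Submodule R M)
  have hAB : A ≤ B := Submodule.smul_mono (Ideal.mul_mono_left (Ideal.pow_le_pow_right n.le_succ))
    le_rfl
  rw [length_quotient_eq_relLength_add_of_le hAB, add_comm]
  gcongr
  have hB : B ≤ s.sup fun x => (𝔞 ^ n • ⊤ : Submodule R M).map (LinearMap.lsmul R M x) := by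
    have : B = Ideal.span (s : Set R) • (𝔞 ^ n • ⊤ : Submodule R M) := by
      rw [← mul_smul, mul_comm]
    rw [this, Submodule.smul_le]
    intro r hr m hm
    induction hr using Submodule.span_induction with
    | mem x hx =>
      exact Finset.le_sup (f := fun x => (𝔞 ^ n • ⊤ : Submodule R M).map (LinearMap.lsmul R M x))
        hx ⟨m, hm, rfl⟩
    | zero => rw [zero_smul]; exact Submodule.zero_mem _
    | add x y _ _ hx hy => rw [add_smul]; exact Submodule.add_mem _ hx hy
    | smul a x _ hx => rw [smul_assoc]; exact Submodule.smul_mem _ _ hx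
  refine (relLength_mono hB A).trans ((relLength_finset_sup_le s _ A).trans ?_)
  refine (Finset.sum_le_card_nsmul _ _ _ fun x hx => ?_).trans (nsmul_eq_mul _ _).le
  refine relLength_map_le _ ?_
  rw [Submodule.map_smul'']
  change _ ≤ (𝔞 ^ (n + 1) * Ideal.span (s : Set R)) • ⊤
  rw [mul_smul]
  refine Submodule.smul_mono le_rfl ?_
  rintro _ ⟨m, -, rfl⟩
  exact Submodule.smul_mem_smul (Ideal.subset_span hx) trivial

lemma map_frobenius_jointIdeal (p : ℕ) [ExpChar R p] (𝔞 I : Ideal R) (t : ℝ) (e : ℕ) :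
    (jointIdeal 𝔞 I t (p ^ e)).map (frobenius R p) =
      (𝔞.map (frobenius R p)) ^ ⌈t * ((p ^ e : ℕ) : ℝ)⌉₊ * bracketPower I (p ^ (e + 1)) := by
  rw [jointIdeal, Ideal.map_mul, Ideal.map_pow, map_frobenius_bracketPower]

lemma map_frobenius_jointIdeal_le (p : ℕ) [ExpChar R p] (𝔞 I : Ideal R) (t : ℝ) (e : ℕ) :
    (jointIdeal 𝔞 I t (p ^ e)).map (frobenius R p) ≤ jointIdeal 𝔞 I t (p ^ (e + 1)) := by
  rw [map_frobenius_jointIdeal, jointIdeal]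
  refine Ideal.mul_mono_left ?_
  refine (Ideal.pow_right_mono (map_frobenius_le_pow p 𝔞) _).trans ?_
  rw [← pow_mul]
  refine Ideal.pow_le_pow_right (Nat.ceil_le.2 ?_)
  push_cast
  have := Nat.le_ceil (t * ((p ^ e : ℕ) : ℝ))
  push_cast at this
  calc t * (p : ℝ) ^ (e + 1) = p * (t * (p : ℝ) ^ e) := by ring
    _ ≤ _ := by gcongr

variable [IsLocalRing R] [IsNoetherianRing R] [Module.Finite R M]

lemma exists_pow_mul_le_jointIdeal {𝔞 I : Ideal R} (h𝔞 : ∃ k, maximalIdeal R ^ k ≤ 𝔞)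
    (hI : ∃ k, maximalIdeal R ^ k ≤ I) (t : ℝ) :
    ∃ K : ℕ, ∀ q, 0 < q → maximalIdeal R ^ (K * q) ≤ jointIdeal 𝔞 I t q := by
  obtain ⟨a, ha⟩ := h𝔞
  obtain ⟨b, hb⟩ := hI
  obtain ⟨μ, hμ⟩ := exists_pow_le_bracketPower (I := I) (IsNoetherian.noetherian _)
  refine ⟨a * ⌈t⌉₊ + b * μ, fun q hq => ?_⟩
  rw [add_mul, pow_add]
  refine Ideal.mul_mono ?_ ?_
  · rw [mul_assoc, pow_mul]
    exact (Ideal.pow_right_mono ha _).trans (Ideal.pow_le_pow_right (ceil_mul_le t q))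
  · rw [mul_assoc, mul_comm μ, pow_mul]
    exact (Ideal.pow_right_mono hb _).trans (hμ q hq)

lemma jointLength_ne_top {𝔞 I : Ideal R} (h𝔞 : ∃ k, maximalIdeal R ^ k ≤ 𝔞)
    (hI : ∃ k, maximalIdeal R ^ k ≤ I) (t : ℝ) (M : Type*) [AddCommGroup M] [Module R M]
    [Module.Finite R M] {q : ℕ} (hq : 0 < q) : jointLength 𝔞 I t M q ≠ ⊤ := by
  obtain ⟨K, hK⟩ := exists_pow_mul_le_jointIdeal h𝔞 hI t
  exact length_quotient_smul_ne_top M ⟨_, hK q hq⟩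

/-- `ℓ_M(q) = O(q ^ s)` as soon as `dim M ≤ s`. -/
lemma exists_jointLength_le {𝔞 I : Ideal R} (h𝔞 : ∃ k, maximalIdeal R ^ k ≤ 𝔞)
    (hI : ∃ k, maximalIdeal R ^ k ≤ I) (t : ℝ) (s : ℕ) (M : Type*) [AddCommGroup M] [Module R M]
    [Module.Finite R M] (h : Module.supportDim R M ≤ s) :
    ∃ C : ℕ, ∀ q : ℕ, 0 < q → jointLength 𝔞 I t M q ≤ C * (q : ℕ∞) ^ s := by
  obtain ⟨K, hK⟩ := exists_pow_mul_le_jointIdeal h𝔞 hI t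
  obtain ⟨C, hC⟩ := exists_length_quotient_pow_le (R := R) (𝔞 := maximalIdeal R)
    ⟨1, (pow_one _).le⟩ s M h
  refine ⟨C * K ^ s, fun q hq => ?_⟩
  refine (length_quotient_anti (Submodule.smul_mono (hK q hq) le_rfl)).trans ((hC _).trans ?_)
  push_cast
  rw [mul_pow, mul_assoc]

/-- `ℓ_M(q)` grows at least like `q ^ s` when `dim M ≥ s`. -/
lemma exists_pow_le_jointLength {𝔞 : Ideal R} (h𝔞 : 𝔞 ≤ maximalIdeal R)
    (I : Ideal R) {t : ℝ} (ht : 0 < t) (s : ℕ) (M : Type*) [AddCommGroup M] [Module R M]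
    [Module.Finite R M] (h : (s : WithBot ℕ∞) ≤ Module.supportDim R M) :
    ∃ C : ℕ, ∀ q : ℕ, 0 < q → (q : ℕ∞) ^ s ≤ C * jointLength 𝔞 I t M q := by
  obtain ⟨C, hC⟩ := exists_pow_le_length_quotient_pow s M h
  refine ⟨⌈t⁻¹⌉₊ ^ s * C, fun q hq => ?_⟩
  set n := ⌈t * (q : ℝ)⌉₊ with hn
  have hq' : (0 : ℝ) < q := by exact_mod_cast hq
  have hn1 : 1 ≤ n := Nat.one_le_ceil_iff.2 (by positivity)
  have hqn : q ≤ ⌈t⁻¹⌉₊ * n := by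
    have h1 : t * (q : ℝ) ≤ n := Nat.le_ceil _
    have h2 : t⁻¹ ≤ (⌈t⁻¹⌉₊ : ℝ) := Nat.le_ceil _
    have h3 : (q : ℝ) ≤ ⌈t⁻¹⌉₊ * n := by
      calc (q : ℝ) = t⁻¹ * (t * q) := by field_simp
        _ ≤ ⌈t⁻¹⌉₊ * n := by gcongr
    exact_mod_cast h3
  have hJ : jointIdeal 𝔞 I t q ≤ maximalIdeal R ^ n :=
    Ideal.mul_le_left.trans (Ideal.pow_right_mono h𝔞 _)
  calc (q : ℕ∞) ^ s ≤ ((⌈t⁻¹⌉₊ * n : ℕ) : ℕ∞) ^ s := by gcongr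
    _ = (⌈t⁻¹⌉₊ : ℕ∞) ^ s * (n : ℕ∞) ^ s := by push_cast; rw [mul_pow]
    _ ≤ (⌈t⁻¹⌉₊ : ℕ∞) ^ s *
        (C * Module.length R (M ⧸ (maximalIdeal R ^ n • ⊤ : Submodule R M))) := by
      gcongr
      exact hC n hn1
    _ ≤ (⌈t⁻¹⌉₊ : ℕ∞) ^ s * (C * jointLength 𝔞 I t M q) := by
      gcongr
      exact length_quotient_anti (Submodule.smul_mono hJ le_rfl)
    _ = _ := by push_cast; rw [mul_assoc]

/-- Changing the exponent of `𝔞` by a bounded amount changes the length only by `O(q ^ (d - 1))`: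
multiplication by the `q`-th powers of generators of `I` covers `𝔞 ^ n I^[q] M` by boundedly many
copies of `𝔞 ^ n M`. -/
lemma exists_length_pow_add_le (p : ℕ) [ExpChar R p] {𝔞 : Ideal R}
    (h𝔞 : ∃ k, maximalIdeal R ^ k ≤ 𝔞) (I : Ideal R) (k : ℕ)
    (h : Module.supportDim R M ≤ (k + 1 : ℕ)) :
    ∃ C : ℕ, ∀ c n e : ℕ,
      Module.length R (M ⧸ ((𝔞 ^ (n + c) * bracketPower I (p ^ e)) • ⊤ : Submodule R M)) ≤
      Module.length R (M ⧸ ((𝔞 ^ n * bracketPower I (p ^ e)) • ⊤ : Submodule R M)) +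
      C * c * ((n + c : ℕ) : ℕ∞) ^ k := by
  classical
  obtain ⟨s, rfl⟩ : I.FG := IsNoetherian.noetherian I
  obtain ⟨C, hC⟩ := exists_relLength_pow_succ_le h𝔞 k M h
  refine ⟨s.card * C, fun c n e => ?_⟩
  have hb : bracketPower (Ideal.span (s : Set R)) (p ^ e) =
      Ideal.span ((s.image fun x => x ^ p ^ e : Finset R) : Set R) := by
    rw [bracketPower_span, Finset.coe_image]
  rw [hb]
  induction c with
  | zero => simp
  | succ c ih =>
    refine (length_quotient_pow_succ_mul_span_le 𝔞 _ (n + c)).trans ?_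
    refine (add_le_add ih (mul_le_mul' (Nat.cast_le.2 Finset.card_image_le) (hC (n + c)))).trans ?_
    rw [add_assoc]
    refine add_le_add le_rfl ?_
    calc ((s.card * C : ℕ) : ℕ∞) * c * ((n + c : ℕ) : ℕ∞) ^ k +
          s.card * (C * ((n + c + 1 : ℕ) : ℕ∞) ^ k)
        ≤ ((s.card * C : ℕ) : ℕ∞) * c * ((n + c + 1 : ℕ) : ℕ∞) ^ k +
          s.card * (C * ((n + c + 1 : ℕ) : ℕ∞) ^ k) :=
          add_le_add (mul_le_mul' le_rfl (pow_le_pow_left' (Nat.cast_le.2 (Nat.le_succ _)) k)) le_rfl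
      _ = _ := by
        rw [add_assoc n c 1]
        push_cast
        ring

/-- Applying Frobenius to the ideal `𝔞^⌈tq⌉ I^[q]` yields the ideal for `p q`, up to a negligible
change of the colength. -/
lemma leUpTo_length_map_frobenius (p : ℕ) [ExpChar R p] {𝔞 : Ideal R}
    (h𝔞 : ∃ k, maximalIdeal R ^ k ≤ 𝔞) (I : Ideal R) (t : ℝ) (k : ℕ)
    (h : Module.supportDim R M ≤ (k + 1 : ℕ)) :
    LeUpTo p k
      (fun e => Module.length R
        (M ⧸ ((jointIdeal 𝔞 I t (p ^ e)).map (frobenius R p) • ⊤ : Submodule R M)))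
      (fun e => jointLength 𝔞 I t M (p ^ (e + 1))) := by
  obtain ⟨C, hC⟩ := exists_length_pow_add_le (M := M) p h𝔞 I k h
  obtain ⟨c, hc⟩ := exists_pow_le_map_frobenius_pow p (I := 𝔞) (IsNoetherian.noetherian _)
  have hp := expChar_pos R p
  refine ⟨C * (c + p) * (⌈t⌉₊ * p + (c + p)) ^ k, fun e => ?_⟩
  set n := ⌈t * ((p ^ (e + 1) : ℕ) : ℝ)⌉₊ with hn
  set m := ⌈t * ((p ^ e : ℕ) : ℝ)⌉₊ with hm
  have hmn : p * m + c ≤ n + (c + p) := by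
    rcases Nat.eq_zero_or_pos m with h0 | h0
    · rw [h0]; omega
    have h1 : ((m : ℝ) - 1) < t * ((p ^ e : ℕ) : ℝ) := by
      have := Nat.ceil_lt_add_one (a := t * ((p ^ e : ℕ) : ℝ)) (Nat.ceil_pos.1 h0).le
      linarith
    have h2 : t * ((p ^ (e + 1) : ℕ) : ℝ) ≤ n := Nat.le_ceil _
    have h3 : (p : ℝ) * (m - 1) ≤ n := by
      refine le_trans ?_ h2
      push_cast at h1 ⊢
      calc (p : ℝ) * (m - 1) ≤ p * (t * (p : ℝ) ^ e) := by gcongr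
        _ = _ := by ring
    have h4 : (p : ℝ) * m ≤ n + p := by linarith
    have h5 : p * m ≤ n + p := by exact_mod_cast h4
    omega
  have hle : 𝔞 ^ (n + (c + p)) * bracketPower I (p ^ (e + 1)) ≤
      (jointIdeal 𝔞 I t (p ^ e)).map (frobenius R p) := by
    rw [map_frobenius_jointIdeal]
    exact Ideal.mul_mono_left ((Ideal.pow_le_pow_right hmn).trans (hc m))
  refine (length_quotient_anti (Submodule.smul_mono hle le_rfl)).trans
    ((hC (c + p) n (e + 1)).trans ?_)
  refine add_le_add le_rfl ?_
  have hn' : n + (c + p) ≤ (⌈t⌉₊ * p + (c + p)) * p ^ e := by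
    have h1 : n ≤ ⌈t⌉₊ * p ^ (e + 1) := ceil_mul_le t _
    have h2 : 1 ≤ p ^ e := Nat.one_le_pow _ _ hp
    calc n + (c + p) ≤ ⌈t⌉₊ * p ^ (e + 1) + (c + p) * p ^ e :=
          add_le_add h1 (Nat.le_mul_of_pos_right _ h2)
      _ = _ := by ring
  calc (C : ℕ∞) * ((c + p : ℕ) : ℕ∞) * ((n + (c + p) : ℕ) : ℕ∞) ^ k
      ≤ C * ((c + p : ℕ) : ℕ∞) * (((⌈t⌉₊ * p + (c + p)) * p ^ e : ℕ) : ℕ∞) ^ k := by gcongr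
    _ = _ := by
      push_cast
      rw [mul_pow, mul_assoc]
      ring

end Joint

/-! ### Leading coefficients of numerical functions -/

/-- The function `f` of `e` has an expansion `c q ^ (k + 1) + O(q ^ k)` with `q = p ^ e`. -/
def HasCoeff (p k : ℕ) (f : ℕ → ℕ∞) : Prop :=
  ∃ c : ℝ, (fun e : ℕ => ((f e).toNat : ℝ) - c * ((p : ℝ) ^ e) ^ (k + 1))
    =O[atTop] (fun e : ℕ => ((p : ℝ) ^ e) ^ k)

section

variable {p k : ℕ} {f g : ℕ → ℕ∞}

lemma LeUpTo.toNat_le (H : LeUpTo p k f g) (hg : ∀ e, g e ≠ ⊤) :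
    ∃ C : ℝ, 0 ≤ C ∧ ∀ e, ((f e).toNat : ℝ) ≤ (g e).toNat + C * ((p : ℝ) ^ e) ^ k := by
  obtain ⟨C, hC⟩ := H
  refine ⟨C, Nat.cast_nonneg _, fun e => ?_⟩
  have h1 := hC e
  obtain ⟨n, hn⟩ := ENat.ne_top_iff_exists.1 (hg e)
  rw [← hn] at h1 ⊢
  have h2 : f e ≤ ((n + C * (p ^ e) ^ k : ℕ) : ℕ∞) := by exact_mod_cast h1
  have h3 := ENat.toNat_le_of_le_natCast h2
  rw [ENat.toNat_natCast]
  exact_mod_cast h3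

lemma isBigO_toNat_sub (hfg : LeUpTo p k f g) (hgf : LeUpTo p k g f) (hf : ∀ e, f e ≠ ⊤)
    (hg : ∀ e, g e ≠ ⊤) :
    (fun e : ℕ => ((f e).toNat : ℝ) - (g e).toNat) =O[atTop] (fun e : ℕ => ((p : ℝ) ^ e) ^ k) := by
  obtain ⟨C, hC0, hC⟩ := hfg.toNat_le hg
  obtain ⟨C', hC0', hC'⟩ := hgf.toNat_le hf
  refine IsBigO.of_bound (C + C') (Eventually.of_forall fun e => ?_)
  have hpos : (0 : ℝ) ≤ ((p : ℝ) ^ e) ^ k := by positivity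
  rw [Real.norm_eq_abs, Real.norm_of_nonneg hpos, abs_le]
  have h1 := mul_nonneg hC0 hpos
  have h2 := mul_nonneg hC0' hpos
  constructor <;> linarith [hC e, hC' e]

lemma HasCoeff.congr (h : HasCoeff p k g) (hfg : LeUpTo p k f g) (hgf : LeUpTo p k g f)
    (hf : ∀ e, f e ≠ ⊤) (hg : ∀ e, g e ≠ ⊤) : HasCoeff p k f := by
  obtain ⟨c, hc⟩ := h
  refine ⟨c, ((isBigO_toNat_sub hfg hgf hf hg).add hc).congr_left fun e => ?_⟩
  ring

lemma HasCoeff.sum {ι : Type*} (s : Finset ι) {f : ι → ℕ → ℕ∞} (h : ∀ i ∈ s, HasCoeff p k (f i))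
    (hf : ∀ i ∈ s, ∀ e, f i e ≠ ⊤) : HasCoeff p k (∑ i ∈ s, f i) := by
  choose! c hc using h
  refine ⟨∑ i ∈ s, c i, (IsBigO.sum hc).congr_left fun e => ?_⟩
  rw [Finset.sum_apply, Finset.sum_sub_distrib, Finset.sum_mul]
  congr 1
  rw [← Nat.cast_sum]
  congr 1
  have h1 : ∀ i ∈ s, ((f i e).toNat : ℕ∞) = f i e := fun i hi => ENat.natCast_toNat (hf i hi e)
  rw [Finset.sum_apply, ← Finset.sum_congr rfl h1, ← Nat.cast_sum, ENat.toNat_natCast]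

lemma HasCoeff.nsmul (r : ℕ) (h : HasCoeff p k f) (hf : ∀ e, f e ≠ ⊤) : HasCoeff p k (r • f) := by
  simpa using HasCoeff.sum (Finset.range r) (f := fun _ => f) (fun _ _ => h) (fun _ _ => hf)

lemma hasCoeff_of_leUpTo_zero (h : LeUpTo p k f 0) : HasCoeff p k f := by
  obtain ⟨C, hC0, hC⟩ := h.toNat_le (g := 0) (fun _ => ENat.zero_ne_top)
  refine ⟨0, IsBigO.of_bound C (Eventually.of_forall fun e => ?_)⟩
  rw [zero_mul, sub_zero, Real.norm_of_nonneg (Nat.cast_nonneg _),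
    Real.norm_of_nonneg (by positivity)]
  simpa using hC e

lemma HasCoeff.of_shift (hp : 0 < p) (h : HasCoeff p k fun e => f (e + 1)) : HasCoeff p k f := by
  obtain ⟨c, hc⟩ := h
  refine ⟨c / (p : ℝ) ^ (k + 1), ?_⟩
  rw [isBigO_iff] at hc ⊢
  obtain ⟨C, hC⟩ := hc
  refine ⟨C / (p : ℝ) ^ k, ?_⟩
  rw [eventually_atTop] at hC ⊢
  obtain ⟨E, hE⟩ := hC
  refine ⟨E + 1, fun e he => ?_⟩
  obtain ⟨e, rfl⟩ := Nat.exists_eq_add_of_le' (show 1 ≤ e by omega)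
  have h1 := hE e (by omega)
  have hp' : (p : ℝ) ≠ 0 := by exact_mod_cast hp.ne'
  have h2 : c / (p : ℝ) ^ (k + 1) * ((p : ℝ) ^ (e + 1)) ^ (k + 1) = c * ((p : ℝ) ^ e) ^ (k + 1) := by
    rw [pow_succ (p : ℝ) e, mul_pow]
    field_simp
  have h3 : C / (p : ℝ) ^ k * ‖((p : ℝ) ^ (e + 1)) ^ k‖ = C * ‖((p : ℝ) ^ e) ^ k‖ := by
    rw [Real.norm_of_nonneg (by positivity), Real.norm_of_nonneg (by positivity),
      pow_succ (p : ℝ) e, mul_pow]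
    field_simp
  rw [h2, h3]
  exact h1

/-- A sequence that grows by at least `η > 0` at each late step is unbounded. -/
lemma not_bounded_of_add_le {w : ℕ → ℝ} {η B : ℝ} (hη : 0 < η) {E : ℕ}
    (h : ∀ e ≥ E, w e + η ≤ w (e + 1)) (hB : ∀ e, w e ≤ B) : False := by
  have h1 : ∀ n : ℕ, w E + n * η ≤ w (E + n) := by
    intro n
    induction n with
    | zero => simp
    | succ n ih =>
      have := h (E + n) (by omega)
      rw [← add_assoc]
      push_cast
      linarith
  obtain ⟨n, hn⟩ := exists_nat_gt ((B - w E) / η)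
  rw [div_lt_iff₀ hη] at hn
  linarith [h1 n, hB (E + n)]

/-- If `f (e + 1) = r f (e) + O(q ^ k)` while `f` has exact order `q ^ (k + 1)`, then necessarily
`r = p ^ (k + 1)`, and `f (e) / q ^ (k + 1)` converges at a geometric rate. -/
lemma hasCoeff_of_recursion (hp : 1 < p) (r : ℕ) (hf : ∀ e, f e ≠ ⊤)
    (h1 : LeUpTo p k (fun e => f (e + 1)) (r • f)) (h2 : LeUpTo p k (r • f) (fun e => f (e + 1)))
    (hle : ∃ C : ℕ, ∀ e, f e ≤ C * ((p : ℕ∞) ^ e) ^ (k + 1))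
    (hge : ∃ C : ℕ, ∀ e, ((p : ℕ∞) ^ e) ^ (k + 1) ≤ C * f e) : HasCoeff p k f := by
  obtain ⟨u, hu⟩ : ∃ u : ℕ → ℕ, ∀ e, f e = u e := by
    have : ∀ e, ∃ n : ℕ, f e = n := fun e => by
      obtain ⟨n, hn⟩ := ENat.ne_top_iff_exists.1 (hf e)
      exact ⟨n, hn.symm⟩
    choose u hu using this
    exact ⟨u, hu⟩
  obtain rfl : f = fun e => (u e : ℕ∞) := funext hu
  have hp0 : (0 : ℝ) < p := by exact_mod_cast (by omega : 0 < p)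
  have hp1 : (1 : ℝ) < p := by exact_mod_cast hp
  obtain ⟨A, hA0, hA⟩ := h1.toNat_le (fun e => by
    rw [Pi.smul_apply, nsmul_eq_mul]; exact ENat.natCast_ne_top (r * u e))
  obtain ⟨A', hA0', hA'⟩ := h2.toNat_le (by simp)
  obtain ⟨B, hB⟩ := hle
  obtain ⟨D, hD⟩ := hge
  set w : ℕ → ℝ := fun e => u e / ((p : ℝ) ^ e) ^ (k + 1) with hw
  set ρ : ℝ := r / (p : ℝ) ^ (k + 1) with hρ
  have hr : ∀ e, ((r • fun e => (u e : ℕ∞)) e).toNat = r * u e := fun e => by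
    simp only [Pi.smul_apply, nsmul_eq_mul]
    rw [← Nat.cast_mul, ENat.toNat_natCast]
  have hpow : ∀ e : ℕ, (0 : ℝ) < ((p : ℝ) ^ e) ^ (k + 1) := fun e => by positivity
  -- the normalized sequence satisfies `w (e + 1) = ρ w (e) + O(p ^ (-e))`
  have hrec : ∀ e, |w (e + 1) - ρ * w e| ≤ (A + A') * (p⁻¹ : ℝ) ^ e := by
    intro e
    have ha := hA e
    have ha' := hA' e
    rw [hr] at ha ha'
    simp only [ENat.toNat_natCast] at ha ha'
    push_cast at ha ha'
    have hk : (0 : ℝ) < ((p : ℝ) ^ e) ^ k := by positivity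
    have e1 : w (e + 1) - ρ * w e =
        ((u (e + 1) : ℝ) - r * u e) / ((p : ℝ) ^ (e + 1)) ^ (k + 1) := by
      simp only [hw, hρ]
      rw [pow_succ (p : ℝ) e, mul_pow]
      field_simp
    have e2 : |(u (e + 1) : ℝ) - r * u e| ≤ (A + A') * ((p : ℝ) ^ e) ^ k := by
      rw [abs_le]
      have h1 := mul_nonneg hA0 hk.le
      have h2 := mul_nonneg hA0' hk.le
      constructor <;> linarith
    rw [e1, abs_div, abs_of_pos (hpow _), div_le_iff₀ (hpow _)]
    refine e2.trans ?_
    rw [mul_assoc]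
    refine mul_le_mul_of_nonneg_left ?_ (by linarith)
    have e3 : (p⁻¹ : ℝ) ^ e * ((p : ℝ) ^ (e + 1)) ^ (k + 1) =
        ((p : ℝ) ^ e) ^ k * (p : ℝ) ^ (k + 1) := by
      rw [pow_succ (p : ℝ) e, mul_pow, pow_succ ((p : ℝ) ^ e) k, inv_pow]
      field_simp
    rw [e3]
    exact le_mul_of_one_le_right hk.le (one_le_pow₀ hp1.le)
  have hwB : ∀ e, w e ≤ B := by
    intro e
    rw [hw, div_le_iff₀ (hpow e)]
    have : (u e : ℕ∞) ≤ B * ((p : ℕ∞) ^ e) ^ (k + 1) := hB e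
    exact_mod_cast this
  have hD0 : (0 : ℝ) < D := by
    have := hD 0
    rcases Nat.eq_zero_or_pos D with h | h
    · simp [h] at this
    · exact_mod_cast h
  have hwD : ∀ e, (D : ℝ)⁻¹ ≤ w e := by
    intro e
    rw [hw, le_div_iff₀ (hpow e), inv_mul_le_iff₀ hD0]
    have : ((p : ℕ∞) ^ e) ^ (k + 1) ≤ D * u e := hD e
    exact_mod_cast this
  have hsmall : ∀ η : ℝ, 0 < η → ∃ E, ∀ e ≥ E, |w (e + 1) - ρ * w e| ≤ η := by
    intro η hη
    have ht : Tendsto (fun e : ℕ => (A + A') * (p⁻¹ : ℝ) ^ e) atTop (nhds ((A + A') * 0)) :=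
      (tendsto_pow_atTop_nhds_zero_of_lt_one (by positivity) (inv_lt_one_of_one_lt₀ hp1)).const_mul _
    rw [mul_zero] at ht
    obtain ⟨E, hE⟩ := eventually_atTop.1 (ht.eventually (ge_mem_nhds hη))
    exact ⟨E, fun e he => (hrec e).trans (hE e he)⟩
  have hDi : (0 : ℝ) < (D : ℝ)⁻¹ := inv_pos.2 hD0
  have hρ1 : ρ = 1 := by
    rcases lt_trichotomy ρ 1 with h | h | h
    · exfalso
      have hη : 0 < (1 - ρ) * (D : ℝ)⁻¹ / 2 := by have := sub_pos.2 h; positivity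
      obtain ⟨E, hE⟩ := hsmall _ hη
      refine not_bounded_of_add_le (w := fun e => -w e) hη (E := E) (B := 0) (fun e he => ?_)
        fun e => by linarith [hwD e]
      have a1 := (abs_le.1 (hE e he)).2
      have a2 := mul_le_mul_of_nonneg_left (hwD e) (sub_pos.2 h).le
      linarith
    · exact h
    · exfalso
      have hη : 0 < (ρ - 1) * (D : ℝ)⁻¹ / 2 := by have := sub_pos.2 h; positivity
      obtain ⟨E, hE⟩ := hsmall _ hη
      refine not_bounded_of_add_le (w := w) hη (E := E) (B := B) (fun e he => ?_) hwB
      have a1 := (abs_le.1 (hE e he)).1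
      have a2 := mul_le_mul_of_nonneg_left (hwD e) (sub_pos.2 h).le
      linarith
  have hdist : ∀ e, dist (w e) (w (e + 1)) ≤ (A + A') * (p⁻¹ : ℝ) ^ e := by
    intro e
    have := hrec e
    rw [hρ1, one_mul] at this
    rwa [dist_comm, Real.dist_eq]
  have hlt : (p⁻¹ : ℝ) < 1 := inv_lt_one_of_one_lt₀ hp1
  obtain ⟨c, hc⟩ := cauchySeq_tendsto_of_complete (cauchySeq_of_le_geometric _ _ hlt hdist)
  refine ⟨c, IsBigO.of_bound ((A + A') / (1 - (p⁻¹ : ℝ))) (Eventually.of_forall fun e => ?_)⟩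
  have hfin := dist_le_of_le_geometric_of_tendsto _ _ hlt hdist hc e
  rw [Real.dist_eq] at hfin
  have e1 : ((u e : ℕ∞).toNat : ℝ) - c * ((p : ℝ) ^ e) ^ (k + 1) =
      (w e - c) * ((p : ℝ) ^ e) ^ (k + 1) := by
    rw [hw, ENat.toNat_natCast, sub_mul, div_mul_cancel₀ _ (hpow e).ne']
  rw [e1, norm_mul, Real.norm_eq_abs, Real.norm_of_nonneg (hpow e).le,
    Real.norm_of_nonneg (by positivity)]
  calc |w e - c| * ((p : ℝ) ^ e) ^ (k + 1)
      ≤ (A + A') * (p⁻¹ : ℝ) ^ e / (1 - (p⁻¹ : ℝ)) * ((p : ℝ) ^ e) ^ (k + 1) := by gcongr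
    _ = _ := by
      rw [pow_succ ((p : ℝ) ^ e) k, inv_pow]
      field_simp

end

/-! ### Restriction of scalars along a map inducing a surjection on residue fields -/

section Restrict

open IsLocalRing

variable {A B : Type*} [CommRing A] [CommRing B] [IsLocalRing B] [Algebra A B]

lemma isSimpleModule_of_residue (hres : ∀ b : B, ∃ a : A, b - algebraMap A B a ∈ maximalIdeal B)
    (S : Type*) [AddCommGroup S] [Module B S] [Module A S] [IsScalarTower A B S]
    [IsSimpleModule B S] : IsSimpleModule A S := by
  rw [isSimpleModule_iff_toSpanSingleton_surjective]
  refine ⟨IsSimpleModule.nontrivial B S, fun x hx y => ?_⟩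
  obtain ⟨b, rfl⟩ := IsSimpleModule.toSpanSingleton_surjective B hx y
  obtain ⟨a, ha⟩ := hres b
  refine ⟨a, ?_⟩
  have hmax := eq_maximalIdeal (IsSimpleModule.annihilator_isMaximal (R := B) (M := S))
  rw [← hmax] at ha
  have h1 := Module.mem_annihilator.1 ha x
  rw [sub_smul, sub_eq_zero, algebraMap_smul] at h1
  simpa using h1.symm

lemma isFiniteLength_and_length_eq_of_residue
    (hres : ∀ b : B, ∃ a : A, b - algebraMap A B a ∈ maximalIdeal B)
    (N : Type*) [AddCommGroup N] [Module B N] (hN : IsFiniteLength B N) :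
    ∀ [Module A N] [IsScalarTower A B N],
      IsFiniteLength A N ∧ Module.length A N = Module.length B N := by
  induction hN with
  | of_subsingleton =>
    intro _ _
    exact ⟨.of_subsingleton, by rw [Module.length_eq_zero, Module.length_eq_zero]⟩
  | of_simple_quotient hN ih =>
    rename_i M _ _ N _
    intro _ _
    obtain ⟨h1, h2⟩ := ih
    have := isSimpleModule_of_residue hres (M ⧸ N)
    have hex : Module.length A M = Module.length A N + Module.length A (M ⧸ N) :=
      Module.length_eq_add_of_exact (N.subtype.restrictScalars A) (N.mkQ.restrictScalars A)
        N.subtype_injective N.mkQ_surjective (LinearMap.exact_subtype_mkQ N)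
    have hex' : Module.length B M = Module.length B N + Module.length B (M ⧸ N) :=
      Module.length_eq_add_of_exact N.subtype N.mkQ N.subtype_injective N.mkQ_surjective
        (LinearMap.exact_subtype_mkQ N)
    rw [Module.length_eq_one A (M ⧸ N), h2] at hex
    rw [Module.length_eq_one B (M ⧸ N)] at hex'
    refine ⟨?_, by rw [hex, hex']⟩
    rw [← Module.length_ne_top_iff, hex, ← h2]
    exact WithTop.add_ne_top.2 ⟨Module.length_ne_top_iff.2 h1, ENat.one_ne_top⟩

lemma length_quotient_smul_of_residue
    (hres : ∀ b : B, ∃ a : A, b - algebraMap A B a ∈ maximalIdeal B)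
    (N : Type*) [AddCommGroup N] [Module B N] [Module A N] [IsScalarTower A B N] (J : Ideal A)
    (hfin : Module.length B (N ⧸ (J.map (algebraMap A B) • ⊤ : Submodule B N)) ≠ ⊤) :
    Module.length A (N ⧸ (J • ⊤ : Submodule A N)) =
      Module.length B (N ⧸ (J.map (algebraMap A B) • ⊤ : Submodule B N)) := by
  rw [← (isFiniteLength_and_length_eq_of_residue hres _ (Module.length_ne_top_iff.1 hfin)).2]
  have h1 : (J • ⊤ : Submodule A N) =
      (J.map (algebraMap A B) • ⊤ : Submodule B N).restrictScalars A := by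
    rw [Ideal.smul_restrictScalars, Submodule.restrictScalars_top]
  rw [h1]
  exact (Submodule.Quotient.restrictScalarsEquiv A _).length_eq

end Restrict

/-! ### Frobenius pushforward -/

/-- The Frobenius pushforward `F_* M`: the abelian group `M` on which `r : R` acts as `r ^ p`. -/
def FrobPush (R : Type*) (p : ℕ) (M : Type*) [CommRing R] [ExpChar R p] [AddCommGroup M]
    [Module R M] : Type _ := M

namespace FrobPush

variable {R : Type*} {p : ℕ} {M : Type*} [CommRing R] [ExpChar R p] [AddCommGroup M] [Module R M]

instance : AddCommGroup (FrobPush R p M) := inferInstanceAs (AddCommGroup M)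

instance : Module R (FrobPush R p M) := Module.compHom M (frobenius R p)

/-- The identity map `M → F_* M`. -/
def of : M ≃+ FrobPush R p M := AddEquiv.refl M

lemma mem_annihilator_iff (r : R) :
    r ∈ Module.annihilator R (FrobPush R p M) ↔ r ^ p ∈ Module.annihilator R M := by
  rw [Module.mem_annihilator, Module.mem_annihilator]
  exact Iff.rfl

end FrobPush

lemma finite_compHom {A B : Type*} [CommRing A] [CommRing B] (φ : A →+* B) (hφ : φ.Finite)
    (N : Type*) [AddCommGroup N] [Module B N] [Module.Finite B N] :
    @Module.Finite A N _ _ (Module.compHom N φ) := by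
  let _ := φ.toAlgebra
  let _ := Module.compHom N φ
  have : IsScalarTower A B N := ⟨fun a b n => by
    change (φ a * b) • n = φ a • b • n
    rw [mul_smul]⟩
  have : Module.Finite A B := hφ
  exact Module.Finite.trans B N

lemma length_compHom_quotient_smul {A B : Type*} [CommRing A] [CommRing B] [IsLocalRing B]
    (φ : A →+* B) (hres : ∀ b : B, ∃ a : A, b - φ a ∈ IsLocalRing.maximalIdeal B)
    (N : Type*) [AddCommGroup N] [Module B N] (J : Ideal A)
    (hfin : Module.length B (N ⧸ (J.map φ • ⊤ : Submodule B N)) ≠ ⊤) :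
    letI := Module.compHom N φ
    Module.length A (N ⧸ (J • ⊤ : Submodule A N)) =
      Module.length B (N ⧸ (J.map φ • ⊤ : Submodule B N)) := by
  let _ := φ.toAlgebra
  let _ := Module.compHom N φ
  have : IsScalarTower A B N := ⟨fun a b n => by
    change (φ a * b) • n = φ a • b • n
    rw [mul_smul]⟩
  exact length_quotient_smul_of_residue hres N J hfin

section

variable {R : Type*} {p : ℕ} [CommRing R] [ExpChar R p]

lemma FrobPush.finite (hF : (frobenius R p).Finite) (M : Type*) [AddCommGroup M] [Module R M]
    [Module.Finite R M] : Module.Finite R (FrobPush R p M) :=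
  finite_compHom (frobenius R p) hF M

variable [IsLocalRing R]

lemma FrobPush.length_quotient_smul
    (hres : ∀ b : R, ∃ a : R, b - a ^ p ∈ IsLocalRing.maximalIdeal R) (M : Type*) [AddCommGroup M]
    [Module R M] (J : Ideal R)
    (hfin : Module.length R (M ⧸ (J.map (frobenius R p) • ⊤ : Submodule R M)) ≠ ⊤) :
    Module.length R (FrobPush R p M ⧸ (J • ⊤ : Submodule R (FrobPush R p M))) =
      Module.length R (M ⧸ (J.map (frobenius R p) • ⊤ : Submodule R M)) :=
  length_compHom_quotient_smul (frobenius R p) hres M J hfin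

end

/-! ### Joint lengths and maps with small cokernel -/

section SmallCokernel

open IsLocalRing

variable {R : Type*} [CommRing R]

lemma supportDim_le_of_annihilator {k : ℕ} (hR : ringKrullDim R ≤ (k + 1 : ℕ)) (T : Type*)
    [AddCommGroup T] [Module R T]
    (hT : ∀ Q ∈ minimalPrimes R, ¬ Module.annihilator R T ≤ Q) :
    Module.supportDim R T ≤ k := by
  by_contra hlt
  rw [not_le] at hlt
  have hlt' : ((k + 1 : ℕ) : WithBot ℕ∞) ≤ Module.supportDim R T := by
    rw [Nat.cast_succ]
    exact ENat.WithBot.add_one_le_iff.2 hlt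
  obtain ⟨l, hl⟩ := Order.le_krullDim_iff.1 hlt'
  have := l.head.1.isPrime
  have hle : Module.annihilator R T ≤ l.head.1.asIdeal :=
    Module.annihilator_le_of_mem_support l.head.2
  obtain ⟨Q, hQ, hQl⟩ := Ideal.exists_minimalPrimes_le (bot_le : (⊥ : Ideal R) ≤ l.head.1.asIdeal)
  have hQp := hQ.1.1
  have hlt2 : (⟨Q, hQp⟩ : PrimeSpectrum R) < (l.map Subtype.val fun _ _ h => h).head := by
    refine lt_of_le_of_ne hQl fun h => hT Q hQ ?_
    have : Q = l.head.1.asIdeal := congrArg PrimeSpectrum.asIdeal h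
    rwa [this]
  have h3 := Order.LTSeries.length_le_krullDim
    ((l.map (Subtype.val : _ → PrimeSpectrum R) fun _ _ h => h).cons ⟨Q, hQp⟩ hlt2)
  have h4 := h3.trans hR
  rw [RelSeries.cons_length, show (l.map Subtype.val fun _ _ h => h).length = k + 1 from hl] at h4
  have h5 : k + 1 + 1 ≤ k + 1 := by exact_mod_cast h4
  omega

lemma jointLength_le_add_coker (𝔞 I : Ideal R) (t : ℝ) {M N : Type*} [AddCommGroup M] [Module R M]
    [AddCommGroup N] [Module R N] (g : M →ₗ[R] N) (q : ℕ) :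
    jointLength 𝔞 I t N q ≤ jointLength 𝔞 I t M q +
      jointLength 𝔞 I t (N ⧸ LinearMap.range g) q :=
  length_quotient_smul_le_of_exact g (LinearMap.range g).mkQ (Submodule.mkQ_surjective _)
    (LinearMap.exact_map_mkQ_range g) _

lemma length_quotient_smul_pi {ι : Type*} [Fintype ι] (N : ι → Type*) [∀ i, AddCommGroup (N i)]
    [∀ i, Module R (N i)] (J : Ideal R) :
    Module.length R ((∀ i, N i) ⧸ (J • ⊤ : Submodule R (∀ i, N i))) =
      ∑ i, Module.length R (N i ⧸ (J • ⊤ : Submodule R (N i))) := by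
  classical
  have h : (J • ⊤ : Submodule R (∀ i, N i)) =
      Submodule.pi Set.univ fun i => (J • ⊤ : Submodule R (N i)) := by
    refine le_antisymm ?_ fun x hx => ?_
    · rw [Submodule.smul_le]
      intro r hr n _ i _
      exact Submodule.smul_mem_smul hr trivial
    · have hx' : x = ∑ i, LinearMap.single R N i (x i) := by
        ext j
        simp [Finset.sum_apply]
      rw [hx']
      refine Submodule.sum_mem _ fun i _ => ?_
      have h1 : LinearMap.single R N i (x i) ∈
          (J • ⊤ : Submodule R (N i)).map (LinearMap.single R N i) := ⟨_, hx i trivial, rfl⟩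
      rw [Submodule.map_smul''] at h1
      exact Submodule.smul_mono le_rfl le_top h1
  rw [h, (Submodule.quotientPi _).length_eq, Module.length_pi_of_fintype]

/-- A finite module `M` killed by a prime `P` is generically isomorphic to `(R / P) ^ r`, in the
sense that there are maps in both directions with torsion cokernels. -/
lemma exists_maps_of_prime (P : Ideal R) [P.IsPrime] (M : Type*) [AddCommGroup M] [Module R M]
    [Module.Finite R M] (hM : P ≤ Module.annihilator R M) :
    ∃ r : ℕ, ∃ c : R, c ∉ P ∧
      (∃ g : (Fin r → R ⧸ P) →ₗ[R] M, ∀ m : M, c • m ∈ LinearMap.range g) ∧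
      (∃ h : M →ₗ[R] (Fin r → R ⧸ P), ∀ v : Fin r → R ⧸ P, c • v ∈ LinearMap.range h) := by
  have htors : Module.IsTorsionBySet R M (P : Set R) :=
    (Module.isTorsionBySet_iff_subset_annihilator R M).2 hM
  let _ : Module (R ⧸ P) M := htors.module
  have : IsScalarTower R (R ⧸ P) M := htors.isScalarTower
  have : Module.Finite (R ⧸ P) M := Module.Finite.of_restrictScalars_finite R _ _
  set r := Module.finrank (R ⧸ P) M
  obtain ⟨v, hv⟩ := exists_linearIndependent_of_le_finrank (R := R ⧸ P) (M := M) le_rfl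
  set W := Submodule.span (R ⧸ P) (Set.range v) with hW
  have hWr : Module.finrank (R ⧸ P) W = r := by
    rw [hW, finrank_span_eq_card hv, Fintype.card_fin]
  have htor : ∀ x : M ⧸ W, ∃ a : R ⧸ P, a ≠ 0 ∧ a • x = 0 := by
    rw [← Module.finrank_eq_zero_iff, Submodule.finrank_quotient, hWr]
    exact Nat.sub_self _
  have htor' : ∀ m : M, ∃ a : R, a ∉ P ∧ a • m ∈ W := by
    intro m
    obtain ⟨a, ha, ham⟩ := htor (W.mkQ m)
    obtain ⟨a, rfl⟩ := Ideal.Quotient.mk_surjective a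
    refine ⟨a, fun h => ha (Ideal.Quotient.eq_zero_iff_mem.2 h), ?_⟩
    rw [← map_smul, Submodule.mkQ_apply, Submodule.Quotient.mk_eq_zero] at ham
    rwa [← algebraMap_smul (R ⧸ P) a m]
  choose a haP haW using htor'
  obtain ⟨s, hs⟩ := Module.Finite.fg_top (R := R) (M := M)
  set c := ∏ m ∈ s, a m with hc
  have hcP : c ∉ P := fun h => by
    obtain ⟨m, _, hm⟩ := (Ideal.IsPrime.prod_mem_iff (p := P)).1 h
    exact haP m hm
  have hcW : ∀ m : M, c • m ∈ W := by
    intro m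
    have hm : m ∈ Submodule.span R (s : Set M) := hs ▸ Submodule.mem_top
    induction hm using Submodule.span_induction with
    | mem m hm =>
      obtain ⟨b, hb⟩ := Finset.dvd_prod_of_mem a hm
      rw [hc, hb, mul_comm, mul_smul, ← algebraMap_smul (R ⧸ P) b]
      exact W.smul_mem _ (haW m)
    | zero => rw [smul_zero]; exact W.zero_mem
    | add x y _ _ hx hy => rw [smul_add]; exact W.add_mem hx hy
    | smul b x _ hx =>
      rw [smul_comm, ← algebraMap_smul (R ⧸ P) b]
      exact W.smul_mem _ hx
  let E := (hv.linearCombinationEquiv).restrictScalars R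
  let F := (Finsupp.linearEquivFunOnFinite (R ⧸ P) (R ⧸ P) (Fin r)).restrictScalars R
  let incl : W →ₗ[R] M := W.subtype.restrictScalars R
  let mulc : M →ₗ[R] W :=
    { toFun := fun m => ⟨c • m, hcW m⟩
      map_add' := fun x y => Subtype.ext (smul_add c x y)
      map_smul' := fun b x => Subtype.ext (smul_comm c b x) }
  refine ⟨r, c, hcP, ⟨incl ∘ₗ E.toLinearMap ∘ₗ F.symm.toLinearMap, fun m => ?_⟩,
    ⟨F.toLinearMap ∘ₗ E.symm.toLinearMap ∘ₗ mulc, fun w => ?_⟩⟩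
  · exact ⟨F (E.symm ⟨c • m, hcW m⟩), by simp [incl]⟩
  · refine ⟨incl (E (F.symm w)), ?_⟩
    have : mulc (incl (E (F.symm w))) = c • E (F.symm w) := rfl
    simp [this]

variable [IsLocalRing R] [IsNoetherianRing R] {p k : ℕ} {𝔞 I : Ideal R}

/-- A linear map whose cokernel vanishes at all minimal primes gives an inequality of joint lengths
up to lower order terms. -/
lemma leUpTo_of_coker (hR : ringKrullDim R ≤ (k + 1 : ℕ)) (hp : 0 < p)
    (h𝔞 : ∃ k, maximalIdeal R ^ k ≤ 𝔞) (hI : ∃ k, maximalIdeal R ^ k ≤ I) (t : ℝ)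
    {M N : Type*} [AddCommGroup M] [Module R M] [AddCommGroup N] [Module R N] [Module.Finite R N]
    (g : M →ₗ[R] N)
    (hg : ∀ Q ∈ minimalPrimes R, ∃ c ∉ Q, ∀ n, c • n ∈ LinearMap.range g) :
    LeUpTo p k (fun e => jointLength 𝔞 I t N (p ^ e)) (fun e => jointLength 𝔞 I t M (p ^ e)) := by
  have hdim : Module.supportDim R (N ⧸ LinearMap.range g) ≤ k := by
    refine supportDim_le_of_annihilator hR _ fun Q hQ hle => ?_
    obtain ⟨c, hc, hcg⟩ := hg Q hQ
    refine hc (hle (Module.mem_annihilator.2 fun x => ?_))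
    obtain ⟨n, rfl⟩ := Submodule.mkQ_surjective _ x
    rw [← map_smul, Submodule.mkQ_apply, Submodule.Quotient.mk_eq_zero]
    exact hcg n
  obtain ⟨C, hC⟩ := exists_jointLength_le h𝔞 hI t k (N ⧸ LinearMap.range g) hdim
  refine ⟨C, fun e => (jointLength_le_add_coker 𝔞 I t g _).trans ?_⟩
  gcongr
  exact_mod_cast hC (p ^ e) (by positivity)

end SmallCokernel

/-! ### Existence of the leading coefficient over an `F`-finite ring with perfect residue field -/

section FFinite

open IsLocalRing

variable {R : Type*} [CommRing R] [IsLocalRing R] [IsNoetherianRing R] {p k : ℕ} {𝔞 I : Ideal R}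

lemma leUpTo_of_killed_by_minimalPrime (hR : ringKrullDim R ≤ (k + 1 : ℕ)) (hp : 0 < p)
    (h𝔞 : ∃ k, maximalIdeal R ^ k ≤ 𝔞) (hI : ∃ k, maximalIdeal R ^ k ≤ I) (t : ℝ)
    {P : Ideal R} (hP : P ∈ minimalPrimes R)
    {M N : Type*} [AddCommGroup M] [Module R M] [AddCommGroup N] [Module R N] [Module.Finite R N]
    (hN : ∀ x ∈ P, ∀ n : N, x • n = 0) (g : M →ₗ[R] N) {c : R} (hc : c ∉ P)
    (hg : ∀ n, c • n ∈ LinearMap.range g) :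
    LeUpTo p k (fun e => jointLength 𝔞 I t N (p ^ e)) (fun e => jointLength 𝔞 I t M (p ^ e)) := by
  refine leUpTo_of_coker hR hp h𝔞 hI t g fun Q hQ => ?_
  by_cases hPQ : P ≤ Q
  · exact ⟨c, fun h => hc (hQ.2 ⟨hP.1.1, hP.1.2⟩ hPQ h), hg⟩
  · obtain ⟨x, hxP, hxQ⟩ := SetLike.not_le_iff_exists.1 hPQ
    exact ⟨x, hxQ, fun n => by rw [hN x hxP n]; exact Submodule.zero_mem _⟩

lemma jointLength_pi_fin {R : Type*} [CommRing R] {𝔞 I : Ideal R} (r : ℕ) (t : ℝ) (N : Type*) [AddCommGroup N] [Module R N] :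
    (fun e => jointLength 𝔞 I t (Fin r → N) (p ^ e)) =
      r • fun e => jointLength 𝔞 I t N (p ^ e) := by
  funext e
  rw [jointLength_eq, length_quotient_smul_pi]
  simp [jointLength_eq]

/-- A finite module killed by a minimal prime `P` has, up to lower order terms, the joint lengths
of a power of `R / P`. -/
lemma exists_leUpTo_nsmul_quotient (hR : ringKrullDim R ≤ (k + 1 : ℕ)) (hp : 0 < p)
    (h𝔞 : ∃ k, maximalIdeal R ^ k ≤ 𝔞) (hI : ∃ k, maximalIdeal R ^ k ≤ I) (t : ℝ)
    {P : Ideal R} (hP : P ∈ minimalPrimes R) (M : Type*) [AddCommGroup M] [Module R M]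
    [Module.Finite R M] (hM : P ≤ Module.annihilator R M) :
    ∃ r : ℕ,
      LeUpTo p k (fun e => jointLength 𝔞 I t M (p ^ e))
        (r • fun e => jointLength 𝔞 I t (R ⧸ P) (p ^ e)) ∧
      LeUpTo p k (r • fun e => jointLength 𝔞 I t (R ⧸ P) (p ^ e))
        (fun e => jointLength 𝔞 I t M (p ^ e)) := by
  have := hP.1.1
  obtain ⟨r, c, hc, ⟨g, hg⟩, ⟨h, hh⟩⟩ := exists_maps_of_prime P M hM
  refine ⟨r, ?_, ?_⟩
  · rw [← jointLength_pi_fin]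
    exact leUpTo_of_killed_by_minimalPrime hR hp h𝔞 hI t hP
      (fun x hx n => Module.mem_annihilator.1 (hM hx) n) g hc hg
  · rw [← jointLength_pi_fin]
    refine leUpTo_of_killed_by_minimalPrime hR hp h𝔞 hI t hP (fun x hx n => ?_) h hc hh
    ext i
    rw [Pi.smul_apply, Algebra.smul_def, Ideal.Quotient.algebraMap_eq,
      Ideal.Quotient.eq_zero_iff_mem.2 hx, zero_mul]
    rfl

variable [Fact p.Prime] [ExpChar R p]

lemma frobPush_leUpTo (hR : ringKrullDim R ≤ (k + 1 : ℕ))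
    (h𝔞 : ∃ k, maximalIdeal R ^ k ≤ 𝔞) (hI : ∃ k, maximalIdeal R ^ k ≤ I) (t : ℝ)
    (hres : ∀ b : R, ∃ a : R, b - a ^ p ∈ maximalIdeal R)
    (M : Type*) [AddCommGroup M] [Module R M] [Module.Finite R M] :
    LeUpTo p k (fun e => jointLength 𝔞 I t (FrobPush R p M) (p ^ e))
      (fun e => jointLength 𝔞 I t M (p ^ (e + 1))) ∧
    LeUpTo p k (fun e => jointLength 𝔞 I t M (p ^ (e + 1)))
      (fun e => jointLength 𝔞 I t (FrobPush R p M) (p ^ e)) := by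
  have hp : 0 < p := (Fact.out : p.Prime).pos
  have key : (fun e => jointLength 𝔞 I t (FrobPush R p M) (p ^ e)) = fun e => Module.length R
      (M ⧸ ((jointIdeal 𝔞 I t (p ^ e)).map (frobenius R p) • ⊤ : Submodule R M)) := by
    funext e
    rw [jointLength_eq]
    refine FrobPush.length_quotient_smul hres M _ (length_quotient_smul_ne_top M ?_)
    obtain ⟨K, hK⟩ := exists_pow_mul_le_jointIdeal h𝔞 hI t
    obtain ⟨μ, hμ⟩ := exists_pow_le_bracketPower (I := jointIdeal 𝔞 I t (p ^ e))
      (IsNoetherian.noetherian _)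
    obtain ⟨j, hj⟩ := exists_pow_le_pow ⟨_, hK (p ^ e) (by positivity)⟩ (p * μ)
    exact ⟨j, hj.trans (hμ p hp)⟩
  rw [key]
  refine ⟨leUpTo_length_map_frobenius p h𝔞 I t k
    ((Module.supportDim_le_ringKrullDim R M).trans hR), LeUpTo.of_le fun e => ?_⟩
  exact length_quotient_anti (Submodule.smul_mono (map_frobenius_jointIdeal_le p 𝔞 I t e) le_rfl)

/-- For a domain `R / P` the pushforward `F_* (R / P)` is generically free, of rank `r` say, so the
joint lengths satisfy `ℓ(p q) = r ℓ(q) + O(q ^ (d - 1))`. -/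
lemma hasCoeff_quotient_minimalPrime (hR : ringKrullDim R ≤ (k + 1 : ℕ))
    (h𝔞 : ∃ k, maximalIdeal R ^ k ≤ 𝔞) (h𝔞' : 𝔞 ≤ maximalIdeal R)
    (hI : ∃ k, maximalIdeal R ^ k ≤ I) {t : ℝ} (ht : 0 < t)
    (hF : (frobenius R p).Finite) (hres : ∀ b : R, ∃ a : R, b - a ^ p ∈ maximalIdeal R)
    {P : Ideal R} (hP : P ∈ minimalPrimes R) :
    HasCoeff p k (fun e => jointLength 𝔞 I t (R ⧸ P) (p ^ e)) := by
  have hpp : p.Prime := Fact.out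
  have hp : 0 < p := hpp.pos
  by_cases hdim : Module.supportDim R (R ⧸ P) ≤ k
  · obtain ⟨C, hC⟩ := exists_jointLength_le h𝔞 hI t k (R ⧸ P) hdim
    refine hasCoeff_of_leUpTo_zero ⟨C, fun e => ?_⟩
    rw [Pi.zero_apply, zero_add]
    exact_mod_cast hC (p ^ e) (by positivity)
  · have hdim' : ((k + 1 : ℕ) : WithBot ℕ∞) ≤ Module.supportDim R (R ⧸ P) := by
      rw [Nat.cast_succ]
      exact ENat.WithBot.add_one_le_iff.2 (not_le.1 hdim)
    have hfin := FrobPush.finite hF (R ⧸ P)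
    obtain ⟨r, hr1, hr2⟩ := exists_leUpTo_nsmul_quotient (p := p) hR hp h𝔞 hI t hP
      (FrobPush R p (R ⧸ P)) (fun x hx => by
        rw [FrobPush.mem_annihilator_iff, Ideal.annihilator_quotient]
        exact Ideal.pow_mem_of_mem P hx p hp)
    obtain ⟨hf1, hf2⟩ := frobPush_leUpTo (p := p) hR h𝔞 hI t hres (R ⧸ P)
    obtain ⟨C, hC⟩ := exists_jointLength_le h𝔞 hI t (k + 1) (R ⧸ P)
      ((Module.supportDim_le_ringKrullDim R _).trans hR)
    obtain ⟨D, hD⟩ := exists_pow_le_jointLength h𝔞' I ht (k + 1) (R ⧸ P) hdim'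
    refine hasCoeff_of_recursion hpp.one_lt r
      (fun e => jointLength_ne_top h𝔞 hI t _ (by positivity)) (hf2.trans hr1) (hr2.trans hf1)
      ⟨C, fun e => ?_⟩ ⟨D, fun e => ?_⟩
    · exact_mod_cast hC (p ^ e) (by positivity)
    · exact_mod_cast hD (p ^ e) (by positivity)

lemma hasCoeff_of_killed_by_minimalPrime (hR : ringKrullDim R ≤ (k + 1 : ℕ))
    (h𝔞 : ∃ k, maximalIdeal R ^ k ≤ 𝔞) (h𝔞' : 𝔞 ≤ maximalIdeal R)
    (hI : ∃ k, maximalIdeal R ^ k ≤ I) {t : ℝ} (ht : 0 < t)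
    (hF : (frobenius R p).Finite) (hres : ∀ b : R, ∃ a : R, b - a ^ p ∈ maximalIdeal R)
    {P : Ideal R} (hP : P ∈ minimalPrimes R) (M : Type*) [AddCommGroup M] [Module R M]
    [Module.Finite R M] (hM : P ≤ Module.annihilator R M) :
    HasCoeff p k (fun e => jointLength 𝔞 I t M (p ^ e)) := by
  have hp : 0 < p := (Fact.out : p.Prime).pos
  obtain ⟨r, hr1, hr2⟩ := exists_leUpTo_nsmul_quotient (p := p) hR hp h𝔞 hI t hP M hM
  have hfin : ∀ e, jointLength 𝔞 I t (R ⧸ P) (p ^ e) ≠ ⊤ := fun e =>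
    jointLength_ne_top h𝔞 hI t _ (by positivity)
  refine ((hasCoeff_quotient_minimalPrime hR h𝔞 h𝔞' hI ht hF hres hP).nsmul r hfin).congr hr1 hr2
    (fun e => jointLength_ne_top h𝔞 hI t _ (by positivity)) fun e => ?_
  obtain ⟨n, hn⟩ := ENat.ne_top_iff_exists.1 (hfin e)
  rw [Pi.smul_apply, nsmul_eq_mul, ← hn]
  exact ENat.natCast_ne_top (r * n)

/-- Over a reduced ring a module is generically the direct sum of its reductions modulo the
minimal primes. -/
lemma hasCoeff_of_killed_by_nilradical (hR : ringKrullDim R ≤ (k + 1 : ℕ))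
    (h𝔞 : ∃ k, maximalIdeal R ^ k ≤ 𝔞) (h𝔞' : 𝔞 ≤ maximalIdeal R)
    (hI : ∃ k, maximalIdeal R ^ k ≤ I) {t : ℝ} (ht : 0 < t)
    (hF : (frobenius R p).Finite) (hres : ∀ b : R, ∃ a : R, b - a ^ p ∈ maximalIdeal R)
    (M : Type*) [AddCommGroup M] [Module R M]
    [Module.Finite R M] (hM : nilradical R ≤ Module.annihilator R M) :
    HasCoeff p k (fun e => jointLength 𝔞 I t M (p ^ e)) := by
  classical
  have hp : 0 < p := (Fact.out : p.Prime).pos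
  have hfinite : (minimalPrimes R).Finite := minimalPrimes.finite_of_isNoetherianRing R
  let _ : Fintype (minimalPrimes R) := hfinite.fintype
  -- `c P` lies in all minimal primes except `P`
  have hex : ∀ P : minimalPrimes R, ∃ c : R, c ∉ P.1 ∧ ∀ Q : minimalPrimes R, Q ≠ P → c ∈ Q.1 := by
    intro P
    have hPp := P.2.1.1
    have hnot : ¬ (∏ Q ∈ Finset.univ.erase P, Q.1) ≤ P.1 := by
      intro h
      obtain ⟨Q, hQ, hQP⟩ := (Ideal.IsPrime.prod_le hPp).1 h
      refine (Finset.mem_erase.1 hQ).1 (Subtype.ext ?_)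
      exact le_antisymm hQP (P.2.2 ⟨Q.2.1.1, Q.2.1.2⟩ hQP)
    obtain ⟨c, hc, hcP⟩ := SetLike.not_le_iff_exists.1 hnot
    exact ⟨c, hcP, fun Q hQ => (Ideal.prod_le_inf.trans
      (Finset.inf_le (Finset.mem_erase.2 ⟨hQ, Finset.mem_univ _⟩))) hc⟩
  choose c hcP hcQ using hex
  set s : R := ∑ P, c P with hs
  have hsP : ∀ Q ∈ minimalPrimes R, s ∉ Q := by
    intro Q hQ h
    refine hcP ⟨Q, hQ⟩ ?_
    have h1 : s = c ⟨Q, hQ⟩ + ∑ P ∈ Finset.univ.erase ⟨Q, hQ⟩, c P :=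
      (Finset.add_sum_erase _ _ (Finset.mem_univ _)).symm
    have h2 : ∑ P ∈ Finset.univ.erase ⟨Q, hQ⟩, c P ∈ Q :=
      Q.sum_mem fun P hP => hcQ P ⟨Q, hQ⟩ (Finset.mem_erase.1 hP).1.symm
    rw [h1] at h
    exact (Q.add_mem_iff_left h2).1 h
  let MP : minimalPrimes R → Type _ := fun P => M ⧸ (P.1 • ⊤ : Submodule R M)
  have hker : ∀ P : minimalPrimes R, (P.1 • ⊤ : Submodule R M) ≤
      LinearMap.ker (LinearMap.lsmul R M (c P)) := by
    intro P
    rw [Submodule.smul_le]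
    intro x hx m _
    rw [LinearMap.mem_ker, LinearMap.lsmul_apply, smul_smul]
    refine Module.mem_annihilator.1 (hM ?_) m
    rw [nilradical, ← Ideal.sInf_minimalPrimes, Ideal.mem_sInf]
    intro Q hQ
    by_cases h : (⟨Q, hQ⟩ : minimalPrimes R) = P
    · exact Q.mul_mem_left _ (by rw [← h] at hx; exact hx)
    · exact Q.mul_mem_right _ (hcQ P ⟨Q, hQ⟩ h)
  have hkill : ∀ P Q : minimalPrimes R, Q ≠ P → ∀ x : MP Q, c P • x = 0 := by
    intro P Q hQP x
    obtain ⟨m, rfl⟩ := Submodule.mkQ_surjective _ x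
    rw [← map_smul, Submodule.mkQ_apply, Submodule.Quotient.mk_eq_zero]
    exact Submodule.smul_mem_smul (hcQ P Q hQP) trivial
  have hsx : ∀ Q : minimalPrimes R, ∀ x : MP Q, s • x = c Q • x := by
    intro Q x
    rw [hs, Finset.sum_smul, Finset.sum_eq_single Q (fun P _ hPQ => hkill P Q hPQ.symm x)
      (fun h => (h (Finset.mem_univ _)).elim)]
  let g₁ : M →ₗ[R] (∀ P, MP P) := LinearMap.pi fun P => Submodule.mkQ _
  let g₂ : (∀ P, MP P) →ₗ[R] M :=
    ∑ P, (Submodule.liftQ _ (LinearMap.lsmul R M (c P)) (hker P)).comp (LinearMap.proj P)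
  have hg₁ : ∀ v : ∀ P, MP P, s • v ∈ LinearMap.range g₁ := by
    intro v
    choose w hw using fun P => Submodule.mkQ_surjective _ (v P)
    refine ⟨∑ P, c P • w P, ?_⟩
    funext Q
    have h1 : g₁ (∑ P, c P • w P) Q = ∑ P, c P • Submodule.mkQ (Q.1 • ⊤ : Submodule R M) (w P) := by
      change Submodule.mkQ _ (∑ P, c P • w P) = _
      rw [map_sum]
      simp only [map_smul]
    rw [h1, Finset.sum_eq_single Q (fun P _ hPQ => hkill P Q hPQ.symm _)
      (fun h => (h (Finset.mem_univ _)).elim), hw, Pi.smul_apply, hsx]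
  have hg₂ : ∀ m : M, s • m ∈ LinearMap.range g₂ := by
    intro m
    refine ⟨g₁ m, ?_⟩
    simp only [g₂, LinearMap.sum_apply, LinearMap.comp_apply]
    rw [hs, Finset.sum_smul]
    rfl
  have hfin : ∀ P : minimalPrimes R, ∀ e, jointLength 𝔞 I t (MP P) (p ^ e) ≠ ⊤ := fun P e =>
    jointLength_ne_top h𝔞 hI t _ (by positivity)
  have hsum : (fun e => jointLength 𝔞 I t (∀ P, MP P) (p ^ e)) =
      ∑ P, fun e => jointLength 𝔞 I t (MP P) (p ^ e) := by
    funext e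
    rw [jointLength_eq, length_quotient_smul_pi, Finset.sum_apply]
    rfl
  have hcoeff : HasCoeff p k (fun e => jointLength 𝔞 I t (∀ P, MP P) (p ^ e)) := by
    rw [hsum]
    refine HasCoeff.sum _ (fun P _ => ?_) fun P _ => hfin P
    refine hasCoeff_of_killed_by_minimalPrime hR h𝔞 h𝔞' hI ht hF hres P.2 _ fun x hx => ?_
    rw [Module.mem_annihilator]
    intro y
    obtain ⟨m, rfl⟩ := Submodule.mkQ_surjective _ y
    rw [← map_smul, Submodule.mkQ_apply, Submodule.Quotient.mk_eq_zero]
    exact Submodule.smul_mem_smul hx trivial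
  exact hcoeff.congr (leUpTo_of_coker hR hp h𝔞 hI t g₂ fun Q hQ => ⟨s, hsP Q hQ, hg₂⟩)
    (leUpTo_of_coker hR hp h𝔞 hI t g₁ fun Q hQ => ⟨s, hsP Q hQ, hg₁⟩)
    (fun e => jointLength_ne_top h𝔞 hI t _ (by positivity))
    (fun e => jointLength_ne_top h𝔞 hI t _ (by positivity))

/-- Existence of the leading coefficient over an `F`-finite ring with perfect residue field. A
sufficiently high Frobenius pushforward of `M` is killed by the nilradical. -/
theorem hasCoeff_of_finite_frobenius (hR : ringKrullDim R ≤ (k + 1 : ℕ))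
    (h𝔞 : ∃ k, maximalIdeal R ^ k ≤ 𝔞) (h𝔞' : 𝔞 ≤ maximalIdeal R)
    (hI : ∃ k, maximalIdeal R ^ k ≤ I) {t : ℝ} (ht : 0 < t)
    (hF : (frobenius R p).Finite) (hres : ∀ b : R, ∃ a : R, b - a ^ p ∈ maximalIdeal R)
    (M : Type*) [AddCommGroup M] [Module R M] [Module.Finite R M] :
    HasCoeff p k (fun e => jointLength 𝔞 I t M (p ^ e)) := by
  have hp : 0 < p := (Fact.out : p.Prime).pos
  have hnil : ∃ n : ℕ, ∀ x ∈ nilradical R, x ^ p ^ n ∈ Module.annihilator R M := by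
    obtain ⟨n, hn⟩ := IsNoetherianRing.isNilpotent_nilradical R
    refine ⟨n, fun x hx => ?_⟩
    have h1 : x ^ n = 0 := by
      have := Ideal.pow_mem_pow hx n
      rwa [hn] at this
    rw [pow_eq_zero_of_le (Nat.lt_pow_self (Fact.out : p.Prime).one_lt).le h1]
    exact Ideal.zero_mem _
  obtain ⟨n, hn⟩ := hnil
  induction n generalizing M with
  | zero =>
    exact hasCoeff_of_killed_by_nilradical hR h𝔞 h𝔞' hI ht hF hres M fun x hx => by
      simpa using hn x hx
  | succ n ih =>
    have := FrobPush.finite hF M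
    have h1 := ih (FrobPush R p M) fun x hx => by
      rw [FrobPush.mem_annihilator_iff, ← pow_mul, ← pow_succ]
      exact hn x hx
    obtain ⟨hf1, hf2⟩ := frobPush_leUpTo (p := p) hR h𝔞 hI t hres M
    exact HasCoeff.of_shift (f := fun e => jointLength 𝔞 I t M (p ^ e)) hp
      (h1.congr hf2 hf1 (fun e => jointLength_ne_top h𝔞 hI t _ (by positivity))
        (fun e => jointLength_ne_top h𝔞 hI t _ (by positivity)))

end FFinite

/-! ### Coefficient fields in characteristic `p` -/

section CoefficientField

/-- A surjection of rings of characteristic `p` onto a field splits if the `p`-th powers of the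
elements of its kernel vanish. The image of the section is a maximal subring `L` which contains all
`p`-th powers and meets the kernel trivially; if `L` did not map onto the field, then `L[a] ≅
L[X] / (X ^ p - a ^ p)` would be a larger one for a suitable `a`. -/
theorem exists_section_of_pow_eq_zero {S K : Type*} [CommRing S] [Field K] (p : ℕ)
    [hp : Fact p.Prime] [ExpChar S p] (π : S →+* K) (hπ : Function.Surjective π)
    (hker : ∀ x, π x = 0 → x ^ p = 0) : ∃ σ : K →+* S, π.comp σ = RingHom.id K := by
  let P : Set (Subring S) := {L | (frobenius S p).range ≤ L ∧ ∀ x ∈ L, π x = 0 → x = 0}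
  have h0 : (frobenius S p).range ∈ P := by
    refine ⟨le_rfl, ?_⟩
    rintro _ ⟨y, rfl⟩ hy
    rw [frobenius_def] at hy ⊢
    rw [map_pow] at hy
    exact hker y (pow_eq_zero_iff hp.out.ne_zero |>.mp hy)
  obtain ⟨L, -, hL⟩ := zorn_le_nonempty₀ P (fun c hc hchain y hy => by
    have hdir : DirectedOn (· ≤ ·) c := hchain.directedOn
    refine ⟨sSup c, ⟨(hc hy).1.trans (le_sSup hy), fun x hx hx0 => ?_⟩, fun z hz => le_sSup hz⟩
    obtain ⟨s, hs, hxs⟩ := (Subring.mem_sSup_of_directedOn ⟨y, hy⟩ hdir).mp hx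
    exact (hc hs).2 x hxs hx0) _ h0
  have hpow : ∀ x : S, x ^ p ∈ L := fun x => hL.prop.1 ⟨x, rfl⟩
  -- an inverse of `x ∈ L` is `x ^ (p - 1) * y ^ p`, where `y` is an inverse modulo the kernel
  have hfield : IsField L := by
    refine ⟨⟨0, 1, fun h => ?_⟩, mul_comm, fun {x} hx => ?_⟩
    · exact one_ne_zero (α := K) (by simpa using congrArg (fun z : L => π z) h.symm)
    · have hx' : π x ≠ 0 := fun h => hx (Subtype.ext (hL.prop.2 _ x.2 h))
      obtain ⟨y, hy⟩ := hπ (π x)⁻¹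
      have h1 := hker (x * y - 1) (by rw [map_sub, map_mul, hy, map_one, mul_inv_cancel₀ hx', sub_self])
      rw [sub_pow_expChar, one_pow, mul_pow, sub_eq_zero] at h1
      refine ⟨x ^ (p - 1) * ⟨y ^ p, hpow y⟩, Subtype.ext ?_⟩
      push_cast
      rw [← mul_assoc, mul_pow_sub_one hp.out.ne_zero, h1]
  let _ : Field L := hfield.toField
  let i : L →+* K := π.comp L.subtype
  have hi : Function.Surjective i := by
    intro z
    obtain ⟨a, rfl⟩ := hπ z
    by_contra hz
    have hirr : Irreducible (Polynomial.X ^ p - Polynomial.C (⟨a ^ p, hpow a⟩ : L)) := by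
      refine X_pow_sub_C_irreducible_of_prime hp.out fun b hb => hz ⟨b, ?_⟩
      have h1 : (b : S) ^ p = a ^ p := congrArg Subtype.val hb
      have h2 : π (b - a) ^ p = 0 := by
        rw [← map_pow, sub_pow_expChar, h1, sub_self, map_zero]
      rw [pow_eq_zero_iff hp.out.ne_zero, map_sub, sub_eq_zero] at h2
      exact h2
    let φ : Polynomial L →+* S := Polynomial.eval₂RingHom L.subtype a
    have hφ : φ (Polynomial.X ^ p - Polynomial.C (⟨a ^ p, hpow a⟩ : L)) = 0 := by
      simp [φ]
    have hmax : (Ideal.span {Polynomial.X ^ p - Polynomial.C (⟨a ^ p, hpow a⟩ : L)}).IsMaximal :=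
      PrincipalIdealRing.isMaximal_of_irreducible hirr
    have hk : Ideal.span {Polynomial.X ^ p - Polynomial.C (⟨a ^ p, hpow a⟩ : L)}
        = RingHom.ker (π.comp φ) := by
      refine hmax.eq_of_le (RingHom.ker_ne_top _) ?_
      rw [Ideal.span_singleton_le_iff_mem, RingHom.mem_ker, RingHom.comp_apply, hφ, map_zero]
    have hmem : φ.range ∈ P := by
      refine ⟨?_, ?_⟩
      · rintro _ ⟨y, rfl⟩
        exact ⟨Polynomial.C ⟨y ^ p, hpow y⟩, by simp [φ, frobenius_def]⟩
      · rintro _ ⟨g, rfl⟩ hg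
        have : g ∈ RingHom.ker (π.comp φ) := hg
        rw [← hk, Ideal.mem_span_singleton] at this
        obtain ⟨w, rfl⟩ := this
        rw [map_mul, hφ, zero_mul]
    have hle : L ≤ φ.range := fun x hx => ⟨Polynomial.C ⟨x, hx⟩, by simp [φ]⟩
    have ha : a ∈ L := hL.le_of_ge hmem hle ⟨Polynomial.X, by simp [φ]⟩
    exact hz ⟨⟨a, ha⟩, rfl⟩
  let e : L ≃+* K := RingEquiv.ofBijective i ⟨i.injective, hi⟩
  refine ⟨L.subtype.comp e.symm.toRingHom, RingHom.ext fun z => ?_⟩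
  exact e.apply_symm_apply z

/-- Every field of characteristic `p` is formally smooth over its prime field. -/
theorem formallySmooth_zmod (p : ℕ) [hp : Fact p.Prime] (K : Type*) [Field K] [Algebra (ZMod p) K] :
    Algebra.FormallySmooth (ZMod p) K := by
  refine Algebra.FormallySmooth.of_comp_surjective fun B _ _ I hI g => ?_
  -- a square-zero extension of `K` is the preimage in `B` of the image of `K` in `B ⧸ I`
  rcases subsingleton_or_nontrivial (B ⧸ I) with hB | hB
  · have hB' : Subsingleton B := by
      rw [Ideal.Quotient.subsingleton_iff] at hB
      have : (1 : B) ∈ I ^ 2 := by rw [hB, Ideal.top_pow]; trivial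
      rw [hI, Ideal.mem_bot] at this
      exact subsingleton_of_zero_eq_one this.symm
    exact ⟨⟨⟨⟨⟨fun _ => 0, Subsingleton.elim _ _⟩, fun _ _ => Subsingleton.elim _ _⟩,
      Subsingleton.elim _ _, fun _ _ => Subsingleton.elim _ _⟩, fun _ => Subsingleton.elim _ _⟩,
      AlgHom.ext fun _ => Subsingleton.elim _ _⟩
  have hBn : Nontrivial B := (Ideal.Quotient.mk_surjective (I := I)).nontrivial
  let S : Subring B := (g : K →+* B ⧸ I).range.comap (Ideal.Quotient.mk I)
  let e : K ≃+* (g : K →+* B ⧸ I).range :=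
    RingEquiv.ofBijective (g : K →+* B ⧸ I).rangeRestrict
      ⟨(g : K →+* B ⧸ I).rangeRestrict.injective, (g : K →+* B ⧸ I).rangeRestrict_surjective⟩
  let π : S →+* K := e.symm.toRingHom.comp
    (((Ideal.Quotient.mk I).comp S.subtype).codRestrict _ fun x => x.2)
  have hgπ : ∀ x : S, g (π x) = Ideal.Quotient.mk I x := fun x =>
    congrArg Subtype.val (e.apply_symm_apply ⟨Ideal.Quotient.mk I x, x.2⟩)
  have : CharP B p := charP_of_injective_algebraMap (algebraMap (ZMod p) B).injective p
  have : CharP S p := (RingHom.charP_iff S.subtype Subtype.val_injective p).mpr inferInstance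
  have : ExpChar S p := ExpChar.prime hp.out
  obtain ⟨σ, hσ⟩ := exists_section_of_pow_eq_zero p π (fun z => by
      obtain ⟨b, hb⟩ := Ideal.Quotient.mk_surjective (g z)
      refine ⟨⟨b, ⟨z, hb.symm⟩⟩, ?_⟩
      exact (g : K →+* B ⧸ I).injective ((hgπ _).trans hb)) (fun x hx => by
      have h1 : (x : B) ∈ I := by
        rw [← Ideal.Quotient.eq_zero_iff_mem, ← hgπ, hx, map_zero]
      have h2 : (x : B) ^ 2 = 0 := by
        rw [← Ideal.mem_bot, ← hI]
        exact Ideal.pow_mem_pow h1 2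
      exact Subtype.ext (by simpa using pow_eq_zero_of_le hp.out.two_le h2))
  refine ⟨AlgHom.mk (S.subtype.comp σ) fun r => ?_, AlgHom.ext fun z => ?_⟩
  · exact RingHom.congr_fun (RingHom.ext_zmod
      ((S.subtype.comp σ).comp (algebraMap (ZMod p) K)) (algebraMap (ZMod p) B)) r
  · have : π (σ z) = z := RingHom.congr_fun hσ z
    exact (hgπ (σ z)).symm.trans (by rw [this])

/-- A complete local ring of characteristic `p` contains its residue field. -/
theorem exists_coefficientField (p : ℕ) [hp : Fact p.Prime] (R : Type*) [CommRing R] [IsLocalRing R]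
    [CharP R p] [IsAdicComplete (IsLocalRing.maximalIdeal R) R] :
    ∃ σ : IsLocalRing.ResidueField R →+* R,
      (IsLocalRing.residue R).comp σ = RingHom.id (IsLocalRing.ResidueField R) := by
  let _ : Algebra (ZMod p) R := ZMod.algebra R p
  have : Algebra.FormallySmooth (ZMod p) (IsLocalRing.ResidueField R) :=
    formallySmooth_zmod p (IsLocalRing.ResidueField R)
  obtain ⟨σ, hσ⟩ := Algebra.FormallySmooth.exists_mkₐ_comp_eq_of_isAdicComplete
    (R := ZMod p) (A := IsLocalRing.ResidueField R) (I := IsLocalRing.maximalIdeal R)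
    (⟨RingHom.id (IsLocalRing.ResidueField R), fun _ => rfl⟩ :
      IsLocalRing.ResidueField R →ₐ[ZMod p] R ⧸ IsLocalRing.maximalIdeal R)
  exact ⟨σ, RingHom.ext fun x => AlgHom.congr_fun hσ x⟩

end CoefficientField

open IsLocalRing TensorProduct
/-! ### Enlarging the residue field -/

section ResidueExtension

variable {A κ : Type*} (K : Type*) [CommRing A] [IsLocalRing A] [Field κ] [Field K] [Algebra κ A]
  [Algebra κ K]

/-- If `κ` is a coefficient field of `A`, then `K` is one of `A ⊗[κ] K`. -/
theorem exists_sub_one_tmul_mem (hκ : ∀ a : A, ∃ c : κ, a - algebraMap κ A c ∈ maximalIdeal A)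
    (x : A ⊗[κ] K) :
    ∃ z : K, x - 1 ⊗ₜ z ∈ (maximalIdeal A).map (algebraMap A (A ⊗[κ] K)) := by
  induction x with
  | zero => exact ⟨0, by simp⟩
  | tmul a k =>
    obtain ⟨c, hc⟩ := hκ a
    refine ⟨c • k, ?_⟩
    have h1 : a ⊗ₜ[κ] k - 1 ⊗ₜ[κ] (c • k)
        = algebraMap A (A ⊗[κ] K) (a - algebraMap κ A c) * (1 ⊗ₜ[κ] k) := by
      rw [← TensorProduct.smul_tmul, ← TensorProduct.sub_tmul, ← Algebra.algebraMap_eq_smul_one,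
        Algebra.TensorProduct.algebraMap_apply, Algebra.TensorProduct.tmul_mul_tmul, mul_one,
        one_mul]
      rfl
    rw [h1]
    exact Ideal.mul_mem_right _ _ (Ideal.mem_map_of_mem _ hc)
  | add x y hx hy =>
    obtain ⟨z, hz⟩ := hx
    obtain ⟨w, hw⟩ := hy
    refine ⟨z + w, ?_⟩
    rw [TensorProduct.tmul_add, add_sub_add_comm]
    exact add_mem hz hw

theorem isMaximal_map_tensorProduct
    (hκ : ∀ a : A, ∃ c : κ, a - algebraMap κ A c ∈ maximalIdeal A) :
    ((maximalIdeal A).map (algebraMap A (A ⊗[κ] K))).IsMaximal := by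
  have hne : (maximalIdeal A).map (algebraMap A (A ⊗[κ] K)) ≠ ⊤ := by
    have := Module.FaithfullyFlat.submodule_ne_top (M := A ⊗[κ] K) (maximalIdeal.isMaximal A)
    intro h
    rw [Ideal.smul_top_eq_map, h] at this
    exact this (Submodule.restrictScalars_top _ _ _)
  have : Nontrivial (A ⊗[κ] K ⧸ (maximalIdeal A).map (algebraMap A (A ⊗[κ] K))) :=
    Ideal.Quotient.nontrivial_iff.mpr hne
  let f : K →+* A ⊗[κ] K ⧸ (maximalIdeal A).map (algebraMap A (A ⊗[κ] K)) :=
    (Ideal.Quotient.mk _).comp (Algebra.TensorProduct.includeRight : K →ₐ[κ] A ⊗[κ] K).toRingHom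
  refine Ideal.Quotient.maximal_of_isField _ ((RingEquiv.ofBijective f ⟨f.injective, ?_⟩).symm
    |>.toMulEquiv.isField (Field.toIsField K))
  intro y
  obtain ⟨x, rfl⟩ := Ideal.Quotient.mk_surjective y
  obtain ⟨z, hz⟩ := exists_sub_one_tmul_mem K hκ x
  exact ⟨z, (Ideal.Quotient.eq.mpr hz).symm⟩

/-- For an algebraic extension `K` of a coefficient field of `A`, the ring `A ⊗[κ] K` is integral
over `A`, so its maximal ideals contract to the maximal ideal of `A`, and only one does. -/
theorem isLocalRing_tensorProduct [Algebra.IsIntegral κ K]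
    (hκ : ∀ a : A, ∃ c : κ, a - algebraMap κ A c ∈ maximalIdeal A) :
    IsLocalRing (A ⊗[κ] K) := by
  have hmax := isMaximal_map_tensorProduct K hκ
  refine IsLocalRing.of_unique_max_ideal ⟨_, hmax, fun Q hQ => (hmax.eq_of_le hQ.ne_top ?_).symm⟩
  have := Ideal.isMaximal_comap_of_isIntegral_of_isMaximal (R := A) Q
  rw [Ideal.map_le_iff_le_comap, eq_maximalIdeal this]

end ResidueExtension

/-! ### Lengths under base change -/

section BaseChange

variable {T : Type*} [CommRing T] [IsLocalRing T]

/-- A module which is killed by a power of the maximal ideal does not change under completion. -/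
theorem nonempty_linearEquiv_adicCompletion_tensorProduct (hfg : (maximalIdeal T).FG) (k : ℕ)
    (P : Type*) [AddCommGroup P] [Module T P] (hP : maximalIdeal T ^ k ≤ Module.annihilator T P) :
    Nonempty (P ≃ₗ[T] AdicCompletion (maximalIdeal T) T ⊗[T] P) := by
  set S := AdicCompletion (maximalIdeal T) T
  have hker : ∀ s : S, AdicCompletion.eval (maximalIdeal T) T k s = 0 → ∀ x : P,
      s ⊗ₜ[T] x = 0 := by
    intro s hs x
    have h1 : s ∈ (maximalIdeal T ^ k • ⊤ : Submodule T S) := by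
      rw [AdicCompletion.pow_smul_top_eq_ker_eval hfg]
      exact hs
    induction h1 using Submodule.smul_induction_on' with
    | smul r hr s' _ =>
      rw [TensorProduct.smul_tmul, Module.mem_annihilator.mp (hP hr), TensorProduct.tmul_zero]
    | add y hy z hz h1 h2 =>
      rw [TensorProduct.add_tmul]
      have h3 : ∀ w ∈ (maximalIdeal T ^ k • ⊤ : Submodule T S),
          AdicCompletion.eval (maximalIdeal T) T k w = 0 := by
        intro w hw
        rw [AdicCompletion.pow_smul_top_eq_ker_eval hfg] at hw
        exact hw
      rw [h1 (h3 y hy), h2 (h3 z hz), add_zero]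
  let act : (T ⧸ (maximalIdeal T ^ k • ⊤ : Submodule T T)) →ₗ[T] P →ₗ[T] P :=
    Submodule.liftQ _ (LinearMap.lsmul T P) (by
      intro r hr
      rw [smul_eq_mul, Ideal.mul_top] at hr
      exact LinearMap.ext fun x => Module.mem_annihilator.mp (hP hr) x)
  let ψ : S ⊗[T] P →ₗ[T] P :=
    TensorProduct.lift (act.comp (AdicCompletion.eval (maximalIdeal T) T k))
  let φ : P →ₗ[T] S ⊗[T] P := TensorProduct.mk T S P 1
  have hone : ∀ r : T, AdicCompletion.eval (maximalIdeal T) T k (algebraMap T S r)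
      = Submodule.Quotient.mk r := fun r => rfl
  have hψφ : ∀ x, ψ (φ x) = x := by
    intro x
    have : AdicCompletion.eval (maximalIdeal T) T k (1 : S) = Submodule.Quotient.mk 1 := rfl
    simp only [ψ, φ, TensorProduct.mk_apply, TensorProduct.lift.tmul, LinearMap.comp_apply, this]
    exact one_smul T x
  refine ⟨LinearEquiv.ofBijective φ ⟨Function.LeftInverse.injective hψφ, fun y => ?_⟩⟩
  induction y with
  | zero => exact ⟨0, map_zero _⟩
  | tmul s x =>
    obtain ⟨r, hr⟩ := Submodule.Quotient.mk_surjective _ (AdicCompletion.eval (maximalIdeal T) T k s)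
    refine ⟨r • x, ?_⟩
    have h1 := hker (s - algebraMap T S r) (by rw [map_sub, hone, hr, sub_self]) x
    rw [TensorProduct.sub_tmul, sub_eq_zero] at h1
    rw [h1, Algebra.algebraMap_eq_smul_one, TensorProduct.smul_tmul]
    rfl
  | add y z hy hz =>
    obtain ⟨a, rfl⟩ := hy
    obtain ⟨b, rfl⟩ := hz
    exact ⟨a + b, map_add _ _ _⟩

theorem length_adicCompletion_tensorProduct (hfg : (maximalIdeal T).FG) (k : ℕ)
    (P : Type*) [AddCommGroup P] [Module T P] (hP : maximalIdeal T ^ k ≤ Module.annihilator T P) :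
    Module.length (AdicCompletion (maximalIdeal T) T)
      (AdicCompletion (maximalIdeal T) T ⊗[T] P) = Module.length T P := by
  obtain ⟨e⟩ := nonempty_linearEquiv_adicCompletion_tensorProduct hfg k P hP
  have := AdicCompletion.isLocalRing_of_fg hfg
  have := AdicCompletion.algebraMap_isLocalHom_of_fg hfg
  have hone : Module.length (ResidueField T)
      (ResidueField (AdicCompletion (maximalIdeal T) T)) = 1 := by
    rw [Module.length_eq_of_surjective (S := ResidueField T)
      (R := ResidueField (AdicCompletion (maximalIdeal T) T))
      (AdicCompletion.residueField_map_bijective_of_fg hfg).2, Module.length_eq_one]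
  rw [e.length_eq, IsLocalRing.length_restrictScalars T (AdicCompletion (maximalIdeal T) T), hone,
    mul_one]

variable {R : Type*} [CommRing R] [IsLocalRing R]

/-- A flat local homomorphism `R → T` which sends the maximal ideal of `R` to generators of that
of `T`, followed by completion, preserves the lengths of the quotients `M ⧸ J M` for cofinite
ideals `J`. -/
theorem length_quotient_map_smul_adicCompletion [Algebra R T] [Module.Flat R T]
    [IsLocalHom (algebraMap R T)] (hRT : (maximalIdeal R).map (algebraMap R T) = maximalIdeal T)
    (hfg : (maximalIdeal T).FG) (M : Type*) [AddCommGroup M] [Module R M] {J : Ideal R}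
    (hJ : ∃ k, maximalIdeal R ^ k ≤ J) :
    Module.length (AdicCompletion (maximalIdeal T) T)
      ((AdicCompletion (maximalIdeal T) T ⊗[R] M) ⧸
        (J.map (algebraMap R (AdicCompletion (maximalIdeal T) T)) •
          (⊤ : Submodule (AdicCompletion (maximalIdeal T) T)
            (AdicCompletion (maximalIdeal T) T ⊗[R] M)))) =
      Module.length R (M ⧸ (J • ⊤ : Submodule R M)) := by
  obtain ⟨k, hk⟩ := hJ
  have : IsSimpleModule T (T ⧸ maximalIdeal T) :=
    isSimpleModule_iff_quot_maximal.mpr ⟨_, maximalIdeal.isMaximal T, ⟨.refl T _⟩⟩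
  rw [(TensorProduct.tensorQuotMapSMulEquivTensorQuot M _ J).length_eq,
    ← (AlgebraTensorModule.cancelBaseChange R T (AdicCompletion (maximalIdeal T) T)
      (AdicCompletion (maximalIdeal T) T) (M ⧸ (J • ⊤ : Submodule R M))).length_eq,
    length_adicCompletion_tensorProduct hfg k, IsLocalRing.length_baseChange R T, hRT,
    Module.length_eq_one T (T ⧸ maximalIdeal T), mul_one]
  rw [← hRT, ← Ideal.map_pow, Ideal.map_le_iff_le_comap]
  intro r hr
  rw [Ideal.mem_comap, Module.mem_annihilator]
  intro x
  induction x with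
  | zero => exact smul_zero _
  | add x y hx hy => rw [smul_add, hx, hy, add_zero]
  | tmul t m =>
    obtain ⟨m, rfl⟩ := Submodule.Quotient.mk_surjective _ m
    rw [algebraMap_smul, ← TensorProduct.tmul_smul, ← Submodule.Quotient.mk_smul,
      (Submodule.Quotient.mk_eq_zero _).mpr (Submodule.smul_mem_smul (hk hr) Submodule.mem_top),
      TensorProduct.tmul_zero]

end BaseChange

/-! ### Complete local rings with a coefficient field -/

section Complete

theorem isPrecomplete_of_finite {R : Type*} [CommRing R] (I : Ideal R) [IsPrecomplete I R]
    (M : Type*) [AddCommGroup M] [Module R M] [Module.Finite R M] : IsPrecomplete I M := by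
  rw [← AdicCompletion.of_surjective_iff]
  intro y
  obtain ⟨x, rfl⟩ := AdicCompletion.ofTensorProduct_surjective_of_finite I M y
  induction x with
  | zero => exact ⟨0, by simp⟩
  | add x y hx hy =>
    obtain ⟨a, ha⟩ := hx
    obtain ⟨b, hb⟩ := hy
    exact ⟨a + b, by rw [map_add, map_add, ha, hb]⟩
  | tmul a m =>
    obtain ⟨r, rfl⟩ := AdicCompletion.of_surjective I R a
    refine ⟨r • m, ?_⟩
    rw [AdicCompletion.ofTensorProduct_tmul, map_smul]
    exact (algebraMap_smul (AdicCompletion I R) r (AdicCompletion.of I M m)).symm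

/-- Generators modulo `I` of a separated module over an `I`-adically complete ring generate. -/
theorem finite_of_finite_quotient {R : Type*} [CommRing R] (I : Ideal R) [IsPrecomplete I R]
    (M : Type*) [AddCommGroup M] [Module R M] [IsHausdorff I M]
    [Module.Finite R (M ⧸ (I • ⊤ : Submodule R M))] : Module.Finite R M := by
  obtain ⟨n, f, hf⟩ := Module.Finite.exists_fin' R (M ⧸ (I • ⊤ : Submodule R M))
  obtain ⟨h, hh⟩ := Module.projective_lifting_property (Submodule.mkQ (I • ⊤ : Submodule R M)) f
    (Submodule.mkQ_surjective _)
  have := isPrecomplete_of_finite I (Fin n → R)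
  exact Module.Finite.of_surjective h
    (surjective_of_mkQ_comp_surjective (I := I) (by rw [hh]; exact hf))

variable {S : Type*} [CommRing S] [IsLocalRing S]

/-- A complete local ring with finitely generated maximal ideal and a coefficient field is a
quotient of a power series ring in finitely many variables. -/
theorem isNoetherianRing_of_coefficientField [IsAdicComplete (maximalIdeal S) S]
    (hfg : (maximalIdeal S).FG) {K : Type*} [Field K] (j : K →+* S)
    (hj : ∀ s : S, ∃ a : K, s - j a ∈ maximalIdeal S) : IsNoetherianRing S := by
  obtain ⟨n, y, hy⟩ := Submodule.fg_iff_exists_fin_generating_family.mp hfg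
  let P := MvPolynomial (Fin n) K
  let J : Ideal P := MvPolynomial.idealOfVars (Fin n) K
  let g : P →+* S := MvPolynomial.eval₂Hom j y
  have hJ : J.map g = maximalIdeal S := by
    rw [Ideal.map_span, ← Set.range_comp]
    have : (g ∘ MvPolynomial.X) = y := funext fun i => MvPolynomial.eval₂Hom_X' j y i
    rw [this]
    exact hy
  have hJn : ∀ k, J ^ k ≤ (maximalIdeal S ^ k).comap g := fun k => by
    rw [← Ideal.map_le_iff_le_comap, Ideal.map_pow, hJ]
  let C := AdicCompletion J P
  let f : (k : ℕ) → C →+* S ⧸ maximalIdeal S ^ k := fun k =>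
    (Ideal.quotientMap _ g (hJn k)).comp (AdicCompletion.evalₐ J k).toRingHom
  have hfr : ∀ k x r, AdicCompletion.evalₐ J k x = Ideal.Quotient.mk (J ^ k) r →
      f k x = Ideal.Quotient.mk (maximalIdeal S ^ k) (g r) := by
    intro k x r hr
    change Ideal.quotientMap _ g (hJn k) (AdicCompletion.evalₐ J k x) = _
    rw [hr, Ideal.quotientMap_mk]
  have hf : ∀ {k l : ℕ} (hle : k ≤ l),
      (Ideal.Quotient.factorPow (maximalIdeal S) hle).comp (f l) = f k := by
    intro k l hle
    ext x
    obtain ⟨x, rfl⟩ := AdicCompletion.mk_surjective J P x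
    have hx : x k - x l ∈ J ^ k := by
      have := x.2 hle
      rwa [SModEq.sub_mem, smul_eq_mul, Ideal.mul_top] at this
    rw [RingHom.comp_apply, hfr l _ _ (AdicCompletion.evalₐ_mk J l x),
      hfr k _ _ (AdicCompletion.evalₐ_mk J k x)]
    refine Eq.symm (Ideal.Quotient.eq.mpr ?_)
    rw [← map_sub]
    exact hJn k hx
  let F : C →+* S := IsAdicComplete.liftRingHom (maximalIdeal S) f hf
  have hF : F.comp (algebraMap P C) = g := by
    refine RingHom.ext fun r => ?_
    refine IsHausdorff.eq_iff_smodEq (I := maximalIdeal S) |>.mpr fun k => ?_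
    have h1 : Ideal.Quotient.mk (maximalIdeal S ^ k) (F (algebraMap P C r))
        = Ideal.Quotient.mk (maximalIdeal S ^ k) (g r) := by
      rw [IsAdicComplete.mk_liftRingHom]
      exact hfr k _ r (AdicCompletion.evalₐ_of J k r)
    rw [SModEq.sub_mem, smul_eq_mul, Ideal.mul_top]
    exact Ideal.Quotient.eq.mp h1
  let I : Ideal C := J.map (algebraMap P C)
  have : IsAdicComplete I C := AdicCompletion.isAdicComplete_self J (MvPolynomial.idealOfVars_fg _ _)
  have hIF : I.map F = maximalIdeal S := by rw [Ideal.map_map, hF, hJ]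
  have : IsHausdorff (I.map F) S := by rw [hIF]; infer_instance
  have hsurj : Function.Surjective F := by
    refine surjective_of_mk_map_comp_surjective (I := I) F fun z => ?_
    obtain ⟨s, rfl⟩ := Ideal.Quotient.mk_surjective z
    obtain ⟨a, ha⟩ := hj s
    refine ⟨algebraMap P C (MvPolynomial.C a), ?_⟩
    rw [RingHom.comp_apply, ← RingHom.comp_apply F, hF, eq_comm, Ideal.Quotient.eq, hIF]
    rwa [show g (MvPolynomial.C a) = j a from MvPolynomial.eval₂Hom_C j y a]
  have : IsNoetherianRing C := isNoetherianRing_of_ringEquiv _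
    (MvPowerSeries.toAdicCompletionAlgEquiv (Fin n) K).toRingEquiv
  exact isNoetherianRing_of_surjective _ _ F hsurj

/-- A complete Noetherian local ring whose residue field is perfect has a finite Frobenius
endomorphism. -/
theorem finite_frobenius {p : ℕ} [Fact p.Prime] [ExpChar S p] [IsNoetherianRing S]
    [IsAdicComplete (maximalIdeal S) S] (hres : ∀ b : S, ∃ a : S, b - a ^ p ∈ maximalIdeal S) :
    (frobenius S p).Finite := by
  obtain ⟨k, hk⟩ : ∃ k, maximalIdeal S ^ k ≤ (maximalIdeal S).map (frobenius S p) := by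
    obtain ⟨c, hc⟩ := exists_pow_le_map_frobenius_pow p (maximalIdeal S).fg_of_isNoetherianRing
    exact ⟨p * 1 + c, (hc 1).trans (pow_one _).le⟩
  have hfin := length_quotient_smul_ne_top S ⟨k, hk⟩
  have hlen := FrobPush.length_quotient_smul hres S (maximalIdeal S) hfin
  rw [← hlen, Module.length_ne_top_iff, isFiniteLength_iff_isNoetherian_isArtinian] at hfin
  have := hfin.1
  have : IsHausdorff (maximalIdeal S) (FrobPush S p S) := by
    refine ⟨fun x hx => ?_⟩
    have h1 : ∀ n, ∀ x ∈ (maximalIdeal S ^ n • ⊤ : Submodule S (FrobPush S p S)),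
        FrobPush.of.symm x ∈ maximalIdeal S ^ n := by
      intro n x hx
      induction hx using Submodule.smul_induction_on' with
      | smul r hr y _ =>
        have h2 : FrobPush.of.symm (r • y) = r ^ p * FrobPush.of.symm y := rfl
        rw [h2]
        exact Ideal.mul_mem_right _ _
          (Ideal.pow_mem_of_mem _ hr p (Fact.out : p.Prime).pos)
      | add y _ z _ h1 h2 => rw [map_add]; exact add_mem h1 h2
    refine FrobPush.of.symm.injective (IsHausdorff.haus' (I := maximalIdeal S) (M := S) _ fun n => ?_)
    rw [SModEq.zero, smul_eq_mul, Ideal.mul_top]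
    exact h1 n x (SModEq.zero.mp (hx n))
  have : Module.Finite S (FrobPush S p S) := finite_of_finite_quotient (maximalIdeal S) _
  exact this

end Complete

/-! ### Reduction to rings with finite Frobenius -/

universe u

/-- A Noetherian local ring of characteristic `p` has a flat local extension `T` whose maximal ideal
is generated by that of `R` and which has an algebraically closed coefficient field: extend scalars
in the completion of `R` from a coefficient field to its algebraic closure. The ring `T` itself need
not be Noetherian, but its completion is. -/
theorem exists_flat_extension_isAlgClosed (p : ℕ) [hp : Fact p.Prime] (R : Type u) [CommRing R]
    [IsLocalRing R] [IsNoetherianRing R] [CharP R p] :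
    ∃ (T : Type u) (_ : CommRing T) (_ : IsLocalRing T) (_ : Algebra R T) (_ : Module.Flat R T)
      (_ : IsLocalHom (algebraMap R T)) (K : Type u) (_ : Field K) (_ : IsAlgClosed K)
      (j : K →+* T), (maximalIdeal R).map (algebraMap R T) = maximalIdeal T ∧
        ∀ s : T, ∃ a : K, s - j a ∈ maximalIdeal T := by
  let A := AdicCompletion (maximalIdeal R) R
  have hA : (maximalIdeal R).map (algebraMap R A) = maximalIdeal A :=
    AdicCompletion.maximalIdeal_eq_map.symm
  have : CharP A p := by
    rw [CharP.charP_iff_prime_eq_zero hp.out, ← map_natCast (algebraMap R A),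
      CharP.cast_eq_zero, map_zero]
  obtain ⟨σ, hσ⟩ := exists_coefficientField p A
  let _ : Algebra (ResidueField A) A := σ.toAlgebra
  have hκ : ∀ a : A, ∃ c : ResidueField A, a - algebraMap (ResidueField A) A c ∈ maximalIdeal A := by
    intro a
    refine ⟨residue A a, ?_⟩
    rw [← residue_eq_zero_iff, map_sub, sub_eq_zero]
    exact (RingHom.congr_fun hσ (residue A a)).symm
  let K := AlgebraicClosure (ResidueField A)
  let T := A ⊗[ResidueField A] K
  have hloc : IsLocalRing T := isLocalRing_tensorProduct K hκ
  have hmax : (maximalIdeal A).map (algebraMap A T) = maximalIdeal T :=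
    eq_maximalIdeal (isMaximal_map_tensorProduct K hκ)
  have : IsScalarTower R A T := inferInstance
  have hRT : (maximalIdeal R).map (algebraMap R T) = maximalIdeal T := by
    rw [IsScalarTower.algebraMap_eq R A T, ← Ideal.map_map, hA, hmax]
  have hflat : Module.Flat R T := Module.Flat.trans R A T
  have hlh : IsLocalHom (algebraMap R T) :=
    ((IsLocalRing.local_hom_TFAE (algebraMap R T)).out 0 2).mpr hRT.le
  refine ⟨T, inferInstance, hloc, inferInstance, hflat, hlh, K, inferInstance, inferInstance,
    (Algebra.TensorProduct.includeRight : K →ₐ[ResidueField A] T).toRingHom, hRT, fun s => ?_⟩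
  rw [← hmax]
  exact exists_sub_one_tmul_mem K hκ s

section Completion

variable {T : Type*} [CommRing T] [IsLocalRing T] {K : Type*} [Field K] (j : K →+* T)

theorem exists_sub_mem_maximalIdeal_adicCompletion [IsLocalRing (AdicCompletion (maximalIdeal T) T)]
    (hfg : (maximalIdeal T).FG) (hj : ∀ s : T, ∃ a : K, s - j a ∈ maximalIdeal T)
    (s : AdicCompletion (maximalIdeal T) T) :
    ∃ a : K, s - algebraMap T _ (j a) ∈ maximalIdeal (AdicCompletion (maximalIdeal T) T) := by
  obtain ⟨t, ht⟩ := Ideal.Quotient.mk_surjective (AdicCompletion.evalOneₐ (maximalIdeal T) s)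
  obtain ⟨a, ha⟩ := hj t
  refine ⟨a, ?_⟩
  rw [AdicCompletion.maximalIdeal_eq_map_of_fg hfg, ← AdicCompletion.ker_evalOneₐ_eq_map _ hfg]
  change AdicCompletion.evalOneₐ (maximalIdeal T) _ = 0
  rw [map_sub, ← ht, AlgHom.commutes]
  exact Ideal.Quotient.eq_zero_iff_mem.mpr ha

end Completion

lemma map_jointIdeal {R S : Type*} [CommRing R] [CommRing S] (p : ℕ) [ExpChar R p] [ExpChar S p]
    (f : R →+* S) (𝔞 I : Ideal R) (t : ℝ) (e : ℕ) :
    (jointIdeal 𝔞 I t (p ^ e)).map f = jointIdeal (𝔞.map f) (I.map f) t (p ^ e) := by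
  rw [jointIdeal, jointIdeal, Ideal.map_mul, Ideal.map_pow, bracketPower_eq_map p,
    bracketPower_eq_map p, Ideal.map_map, Ideal.map_map]
  congr 2
  ext x
  simp [iterateFrobenius_def]

/-- Krull dimensions of Noetherian local rings can be compared through Hilbert–Samuel functions. -/
lemma ringKrullDim_le_of_length_le {R S : Type*} [CommRing R] [IsLocalRing R] [IsNoetherianRing R]
    [CommRing S] [IsLocalRing S] [IsNoetherianRing S] (s : ℕ) (hR : ringKrullDim R ≤ s)
    (h : ∀ n, Module.length S (S ⧸ (maximalIdeal S ^ n • ⊤ : Ideal S)) ≤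
      Module.length R (R ⧸ (maximalIdeal R ^ n • ⊤ : Ideal R))) : ringKrullDim S ≤ s := by
  by_contra hS
  rw [not_le] at hS
  have hS' : ((s + 1 : ℕ) : WithBot ℕ∞) ≤ Module.supportDim S S := by
    rw [Module.supportDim_self_eq_ringKrullDim]
    push_cast
    exact ENat.WithBot.add_one_le_iff.2 hS
  obtain ⟨C, hC⟩ := exists_pow_le_length_quotient_pow (s + 1) S hS'
  obtain ⟨D, hD⟩ := exists_length_quotient_pow_le (𝔞 := maximalIdeal R) ⟨1, (pow_one _).le⟩ s R
    (by rwa [Module.supportDim_self_eq_ringKrullDim])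
  have h1 : ((C * D + 1 : ℕ) : ℕ∞) ^ (s + 1) ≤ C * (D * ((C * D + 1 : ℕ) : ℕ∞) ^ s) :=
    (hC _ (Nat.le_add_left 1 _)).trans (mul_le_mul_right ((h _).trans (hD _)) _)
  have h2 : (C * D + 1) ^ (s + 1) ≤ C * (D * (C * D + 1) ^ s) := by exact_mod_cast h1
  have h3 : 0 < (C * D + 1) ^ s := by positivity
  rw [pow_succ', ← mul_assoc] at h2
  exact absurd (Nat.le_of_mul_le_mul_right h2 h3) (by omega)

/-- If the quotients of `R` and of `M` by cofinite ideals keep their lengths in an extension `S` of `R`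
with finite Frobenius, then the expansion of the joint length over `S` is one over `R`. -/
theorem hasCoeff_jointLength_of_extension {R S : Type*} [CommRing R] [IsLocalRing R]
    [IsNoetherianRing R] [CommRing S] [IsLocalRing S] [IsNoetherianRing S] [Algebra R S]
    {p k : ℕ} [hp : Fact p.Prime] [ExpChar R p] [ExpChar S p] {𝔞 I : Ideal R}
    (hR : ringKrullDim R ≤ (k + 1 : ℕ))
    (h𝔞 : ∃ k, maximalIdeal R ^ k ≤ 𝔞) (h𝔞' : 𝔞 ≤ maximalIdeal R)
    (hI : ∃ k, maximalIdeal R ^ k ≤ I) {t : ℝ} (ht : 0 < t)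
    (M : Type*) [AddCommGroup M] [Module R M] [Module.Finite R M]
    (hRS : (maximalIdeal R).map (algebraMap R S) = maximalIdeal S)
    (hF : (frobenius S p).Finite) (hres : ∀ b : S, ∃ a : S, b - a ^ p ∈ maximalIdeal S)
    (hlen : ∀ J : Ideal R, (∃ k, maximalIdeal R ^ k ≤ J) →
      Module.length S ((S ⊗[R] R) ⧸ (J.map (algebraMap R S) • (⊤ : Submodule S (S ⊗[R] R)))) =
        Module.length R (R ⧸ (J • ⊤ : Submodule R R)))
    (hlenM : ∀ J : Ideal R, (∃ k, maximalIdeal R ^ k ≤ J) →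
      Module.length S ((S ⊗[R] M) ⧸ (J.map (algebraMap R S) • (⊤ : Submodule S (S ⊗[R] M)))) =
        Module.length R (M ⧸ (J • ⊤ : Submodule R M))) :
    HasCoeff p k (fun e => jointLength 𝔞 I t M (p ^ e)) := by
  have hS : ringKrullDim S ≤ (k + 1 : ℕ) := by
    refine ringKrullDim_le_of_length_le (R := R) _ hR fun n => ?_
    rw [← hlen _ ⟨n, le_rfl⟩, Ideal.map_pow, hRS]
    exact length_quotient_smul_le_of_surjective (AlgebraTensorModule.rid R S S).toLinearMap
      (AlgebraTensorModule.rid R S S).surjective _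
  have hmap : ∀ {J : Ideal R}, (∃ k, maximalIdeal R ^ k ≤ J) →
      ∃ k, maximalIdeal S ^ k ≤ J.map (algebraMap R S) := by
    rintro J ⟨n, hn⟩
    refine ⟨n, ?_⟩
    rw [← hRS, ← Ideal.map_pow]
    exact Ideal.map_mono hn
  have key := hasCoeff_of_finite_frobenius hS (hmap h𝔞) (hRS ▸ Ideal.map_mono h𝔞') (hmap hI) ht
    hF hres (S ⊗[R] M)
  have heq : ∀ e, jointLength (𝔞.map (algebraMap R S)) (I.map (algebraMap R S)) t (S ⊗[R] M) (p ^ e)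
      = jointLength 𝔞 I t M (p ^ e) := by
    intro e
    obtain ⟨n, hn⟩ := exists_pow_mul_le_jointIdeal h𝔞 hI t
    rw [jointLength_eq, ← map_jointIdeal]
    exact hlenM _ ⟨_, hn _ (pow_pos hp.out.pos e)⟩
  simpa only [heq] using key

/-- The length of `M / 𝔞 ^ ⌈tq⌉ I^[q] M` has an asymptotic expansion over every Noetherian local ring
of characteristic `p`. -/
theorem hasCoeff_jointLength {R : Type u} [CommRing R] [IsLocalRing R] [IsNoetherianRing R]
    {p k : ℕ} [hp : Fact p.Prime] [CharP R p] {𝔞 I : Ideal R} (hR : ringKrullDim R ≤ (k + 1 : ℕ))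
    (h𝔞 : ∃ k, maximalIdeal R ^ k ≤ 𝔞) (h𝔞' : 𝔞 ≤ maximalIdeal R)
    (hI : ∃ k, maximalIdeal R ^ k ≤ I) {t : ℝ} (ht : 0 < t)
    (M : Type*) [AddCommGroup M] [Module R M] [Module.Finite R M] :
    HasCoeff p k (fun e => jointLength 𝔞 I t M (p ^ e)) := by
  have : ExpChar R p := ExpChar.prime hp.out
  obtain ⟨T, _, _, _, _, _, K, _, _, j, hRT, hj⟩ := exists_flat_extension_isAlgClosed p R
  have hfg : (maximalIdeal T).FG := by
    rw [← hRT]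
    exact (maximalIdeal R).fg_of_isNoetherianRing.map _
  let S := AdicCompletion (maximalIdeal T) T
  have : IsLocalRing S := AdicCompletion.isLocalRing_of_fg hfg
  have : IsAdicComplete (maximalIdeal S) S := AdicCompletion.isAdicComplete_of_fg hfg
  have hRS : (maximalIdeal R).map (algebraMap R S) = maximalIdeal S := by
    rw [IsScalarTower.algebraMap_eq R T S, ← Ideal.map_map, hRT,
      AdicCompletion.maximalIdeal_eq_map_of_fg hfg]
  have : CharP S p := by
    rw [CharP.charP_iff_prime_eq_zero hp.out, ← map_natCast (algebraMap R S),
      CharP.cast_eq_zero, map_zero]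
  have : ExpChar S p := ExpChar.prime hp.out
  have hjS := exists_sub_mem_maximalIdeal_adicCompletion j hfg hj
  have : IsNoetherianRing S := isNoetherianRing_of_coefficientField
    (hRS ▸ (maximalIdeal R).fg_of_isNoetherianRing.map _) ((algebraMap T S).comp j) hjS
  have hres : ∀ b : S, ∃ a : S, b - a ^ p ∈ maximalIdeal S := by
    intro b
    obtain ⟨a, ha⟩ := hjS b
    obtain ⟨c, rfl⟩ := IsAlgClosed.exists_pow_nat_eq a hp.out.pos
    exact ⟨algebraMap T S (j c), by rwa [← map_pow, ← map_pow]⟩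
  exact hasCoeff_jointLength_of_extension (S := S) hR h𝔞 h𝔞' hI ht M hRS (finite_frobenius hres) hres
    (fun _ hJ => length_quotient_map_smul_adicCompletion hRT hfg R hJ)
    (fun _ hJ => length_quotient_map_smul_adicCompletion hRT hfg M hJ)

/-! ### The leading coefficient -/

section LeadingCoeff

open Topology

lemma tendsto_natCast_pow_atTop {p : ℕ} (hp : 1 < p) :
    Tendsto (fun e : ℕ => (p : ℝ) ^ e) atTop atTop :=
  tendsto_pow_atTop_atTop_of_one_lt (by exact_mod_cast hp)

/-- An expansion `u = c q ^ (k + 1) + O(q ^ k)` determines `c` as the limit of `u / q ^ (k + 1)`. -/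
lemma tendsto_div_of_isBigO {p k : ℕ} (hp : 1 < p) {u : ℕ → ℝ} {c : ℝ}
    (h : (fun e : ℕ => u e - c * ((p : ℝ) ^ e) ^ (k + 1)) =O[atTop]
      (fun e : ℕ => ((p : ℝ) ^ e) ^ k)) :
    Tendsto (fun e : ℕ => u e / ((p : ℝ) ^ e) ^ (k + 1)) atTop (𝓝 c) := by
  have hpos : ∀ e : ℕ, (0 : ℝ) < (p : ℝ) ^ e := fun e => by positivity
  have h1 : Tendsto (fun e : ℕ => ((p : ℝ) ^ e)⁻¹) atTop (𝓝 0) :=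
    tendsto_inv_atTop_zero.comp (tendsto_natCast_pow_atTop hp)
  have h2 := h.mul (isBigO_refl (fun e : ℕ => (((p : ℝ) ^ e) ^ (k + 1))⁻¹) atTop)
  have h3 : Tendsto (fun e : ℕ => u e / ((p : ℝ) ^ e) ^ (k + 1) - c) atTop (𝓝 0) := by
    refine (h2.trans_tendsto (h1.congr fun e => ?_)).congr fun e => ?_
    · rw [pow_succ, mul_inv, ← mul_assoc, mul_inv_cancel₀ (pow_pos (hpos e) k).ne', one_mul]
    · rw [sub_mul, mul_assoc, mul_inv_cancel₀ (pow_pos (hpos e) _).ne', mul_one, div_eq_mul_inv]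
  simpa using h3.add_const c

end LeadingCoeff

lemma IsMPrimary.le_maximalIdeal {R : Type*} [CommRing R] [IsLocalRing R] {I : Ideal R}
    (h : IsMPrimary I) : I ≤ IsLocalRing.maximalIdeal R := h.2 ▸ Ideal.le_radical

lemma IsMPrimary.exists_pow_le {R : Type*} [CommRing R] [IsLocalRing R] [IsNoetherianRing R]
    {I : Ideal R} (h : IsMPrimary I) : ∃ k, IsLocalRing.maximalIdeal R ^ k ≤ I :=
  h.2 ▸ I.exists_radical_pow_le_of_fg (Ideal.fg_of_isNoetherianRing _)

section Main

variable {R : Type*} [CommRing R] [IsLocalRing R] [IsNoetherianRing R] {p k : ℕ} {𝔞 I : Ideal R}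

/-- The joint length grows with exponent `k + 1` exactly when the module has full dimension. -/
lemma HasLeadingCoeff.nonneg_and_pos_iff (hp : 1 < p) (hR : ringKrullDim R = (k + 1 : ℕ))
    (h𝔞 : IsMPrimary 𝔞) (hI : IsMPrimary I) {t : ℝ} (ht : 0 < t)
    (M : Type*) [AddCommGroup M] [Module R M] [Module.Finite R M] {c : ℝ}
    (hc : HasLeadingCoeff p (k + 1) 𝔞 I t M c) :
    0 ≤ c ∧ (0 < c ↔ Module.supportDim R M = (k + 1 : ℕ)) := by
  have hppos : ∀ e, 0 < p ^ e := fun e => pow_pos (by omega) e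
  have hlim := tendsto_div_of_isBigO hp hc
  have hfin : ∀ e, jointLength 𝔞 I t M (p ^ e) ≠ ⊤ := fun e =>
    jointLength_ne_top h𝔞.exists_pow_le hI.exists_pow_le t M (hppos e)
  refine ⟨ge_of_tendsto' hlim fun e => div_nonneg (Nat.cast_nonneg _) (by positivity),
    fun hpos => ?_, fun hdim => ?_⟩
  · by_contra hne
    have hlt : Module.supportDim R M < (k + 1 : ℕ) :=
      lt_of_le_of_ne (hR ▸ Module.supportDim_le_ringKrullDim R M) hne
    have hle : Module.supportDim R M ≤ k := by
      by_contra h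
      rw [not_le] at h
      have := ENat.WithBot.add_one_le_iff.2 h
      exact absurd hlt (not_lt.2 (by exact_mod_cast this))
    obtain ⟨C, hC⟩ := exists_jointLength_le h𝔞.exists_pow_le hI.exists_pow_le t k M hle
    have h0 : HasLeadingCoeff p (k + 1) 𝔞 I t M 0 := by
      refine IsBigO.of_bound C (Eventually.of_forall fun e => ?_)
      have h1 := hC (p ^ e) (hppos e)
      obtain ⟨n, hn⟩ := ENat.ne_top_iff_exists.1 (hfin e)
      rw [zero_mul, sub_zero, ell, ← hn, ENat.toNat_natCast, Real.norm_of_nonneg (Nat.cast_nonneg _),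
        Real.norm_of_nonneg (by positivity), Nat.add_sub_cancel]
      rw [← hn] at h1
      exact_mod_cast h1
    exact hpos.ne' (tendsto_nhds_unique hlim (tendsto_div_of_isBigO hp h0))
  · obtain ⟨C, hC⟩ := exists_pow_le_jointLength h𝔞.le_maximalIdeal I ht (k + 1) M hdim.ge
    have h1 : ∀ e : ℕ, ((p : ℝ) ^ e) ^ (k + 1) ≤ C * ell 𝔞 I t M (p ^ e) := by
      intro e
      have h1 := hC (p ^ e) (hppos e)
      obtain ⟨n, hn⟩ := ENat.ne_top_iff_exists.1 (hfin e)
      rw [← hn] at h1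
      rw [ell, ← hn, ENat.toNat_natCast]
      exact_mod_cast h1
    have h2 : (1 : ℝ) ≤ C * c := by
      refine ge_of_tendsto' (hlim.const_mul (C : ℝ)) fun e => ?_
      rw [← mul_div_assoc, one_le_div (by positivity)]
      exact h1 e
    exact (pos_iff_pos_of_mul_pos (lt_of_lt_of_le one_pos h2)).1
      (Nat.cast_pos.2 (Nat.pos_of_ne_zero fun h => by norm_num [h] at h2))

end Main

end JointHK

theorem theorem3p1 {R : Type*} [CommRing R] [IsLocalRing R] [IsNoetherianRing R]
    (p : ℕ) [Fact p.Prime] [CharP R p]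
    (d : ℕ) (hd : 0 < d) (hdim : ringKrullDim R = (d : WithBot ℕ∞))
    (𝔞 I : Ideal R) (h𝔞 : JointHK.IsMPrimary 𝔞) (hI : JointHK.IsMPrimary I)
    (t : ℝ) (ht : 0 < t)
    (M : Type*) [AddCommGroup M] [Module R M] [Module.Finite R M] :
    (∀ e : ℕ, JointHK.jointLength 𝔞 I t M (p ^ e) ≠ ⊤) ∧
    (∃! c : ℝ, JointHK.HasLeadingCoeff p d 𝔞 I t M c) ∧
    (∀ c : ℝ, JointHK.HasLeadingCoeff p d 𝔞 I t M c →
      0 ≤ c ∧ (0 < c ↔ Module.supportDim R M = (d : WithBot ℕ∞))) ∧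
    JointHK.HasLeadingCoeff p d 𝔞 I t R (JointHK.jointHKMultiplicity p d 𝔞 I t) ∧
    0 < JointHK.jointHKMultiplicity p d 𝔞 I t := by
  obtain ⟨k, rfl⟩ : ∃ k, d = k + 1 := ⟨d - 1, by omega⟩
  have hp : 1 < p := (Fact.out : p.Prime).one_lt
  obtain ⟨c, hc⟩ := JointHK.hasCoeff_jointLength hdim.le h𝔞.exists_pow_le h𝔞.le_maximalIdeal
    hI.exists_pow_le ht M
  obtain ⟨c', hc'⟩ := JointHK.hasCoeff_jointLength hdim.le h𝔞.exists_pow_le h𝔞.le_maximalIdeal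
    hI.exists_pow_le ht R
  have hc'' : JointHK.HasLeadingCoeff p (k + 1) 𝔞 I t R c' := hc'
  have hlim : JointHK.jointHKMultiplicity p (k + 1) 𝔞 I t = c' :=
    (JointHK.tendsto_div_of_isBigO hp hc'').limUnder_eq
  refine ⟨fun e => JointHK.jointLength_ne_top h𝔞.exists_pow_le hI.exists_pow_le t M
    (pow_pos (by omega) e), ⟨c, hc, fun b hb => ?_⟩, fun b hb => ?_, hlim ▸ hc'', ?_⟩
  · exact tendsto_nhds_unique (JointHK.tendsto_div_of_isBigO hp hb)
      (JointHK.tendsto_div_of_isBigO hp hc)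
  · exact hb.nonneg_and_pos_iff hp hdim h𝔞 hI ht M
  · rw [hlim]
    exact (hc''.nonneg_and_pos_iff hp hdim h𝔞 hI ht R).2.2
      ((Module.supportDim_self_eq_ringKrullDim R).trans hdim)
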